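/- Let $k$ be an algebraically closed field of characteristic $p>2$ and $X=\mathbb P^1_k$ with coordinate $x$. A deformation datum is a pair $(Z,\omega)$, where $Z\to X$ is a finite Galois cover of (connected) smooth projective curves with group $H$, and $\omega\neq 0$ is a meromorphic differential on $Z$ with $\omega=df/f$ for some rational function $f\ne0$ on $Z$ and $\beta^*\omega=\chi(\beta)\,\omega$ for all $\beta\in H$, for an injective character $\chi:H\to\mathbb F_p^\times$. For $P\in X$ put $\sigma_P=(\mathrm{ord}_z(\omega)+1)/|H_z|$, where $z\in Z$ is a point above $P$ with stabilizer $H_z$. This is an element of $\frac1{p-1}\mathbb Z$, so it has a residue in $\mathbb F_p$, and $\sigma_P=\frac{a_P}{p-1}+\nu_P$ with unique integers $0\le a_P<p-1$ and $\nu_P$. The point $P$ is critical if $\sigma_P\ne1$, supersingular if $\sigma_P=\frac{p+1}{p-1}$, and a singularity if it is critical, not supersingular, and $\sigma_P\not\equiv1\pmod p$. Let $r$ be the number of singularities. Assume that $(Z,\omega)$ is nontrivial, i.e. $r\neq2$, and that $\infty$ is a singularity. Then there are only finitely many critical points. Let $x_1,\dots,x_{r-1},x_r=\infty$ be the singularities,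 write $\sigma_i,a_i,\nu_i$ for $\sigma_{x_i},a_{x_i},\nu_{x_i}$, let $u\in k[x]$ be the monic polynomial with simple zeros exactly at the supersingular points, $d=\deg u$, and $Q=\prod_{i=1}^{r-1}(x-x_i)^{1+a_i-\nu_i}$. There is a polynomial $P_2=d(d-\sigma_r)x^{r-3}+\beta_{r-4}x^{r-4}+\dots+\beta_0\in k[x]$ (in particular $r\ge3$ and $\deg P_2\le r-3$) such that for $D=d/dx$ and $$L_\omega=D^2+\frac{Q'}{Q}\,D+\frac{P_2}{\prod_{i=1}^{r-1}(x-x_i)}$$ the following hold. (a) $L_\omega(u)=0$. (b) $L_\omega$ is Fuchsian with singularities in $x_1,\dots,x_r=\infty$ (that is, for $L_\omega=D^2+p_1D+p_2$ the functions $p_1,p_2$ are regular outside the $x_i$, $p_j$ has a pole of order at most $j$ at each $x_i\ne\infty$, and $p_j$ vanishes to order at least $j$ at $\infty$), and it is normalized (it has nilpotent $p$-curvature, and its unique monic polynomial solution of minimal degree has no zero at $x_1,\dots,x_{r-1}$). Its local exponents are $\{\sigma_i,0\}\pmod p$ at $x_i\neq\infty$ and $\{-d,-d+\sigma_r\}\pmod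 p$ at $\infty$. Here the local exponents $\{\alpha,\alpha'\}$ at $x_i\ne\infty$ are given by $\alpha+\alpha'=1-\big((x-x_i)p_1\big)(x_i)$ and $\alpha\alpha'=\big((x-x_i)^2p_2\big)(x_i)$, and those at $\infty$ by $\alpha+\alpha'=-1+(xp_1)(\infty)$ and $\alpha\alpha'=(x^2p_2)(\infty)$. (c) The $p$-curvature of $L_\omega$ is nilpotent (both $L_\omega$ and $D+Q'/Q$ have a nonzero polynomial solution) and nonzero (the polynomial solutions of $L_\omega$ form a module of rank one over $k[x]^p$). -/

import Mathlib

noncomputable section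

namespace DefData

open Polynomial KaehlerDifferential

/-! ### Rational functions on the projective line -/

section RationalFunctions

variable {k : Type*} [Field k]

/-- The derivation `d/dx` of the field `k(x)`, by the quotient rule. -/
def ratDeriv (f : RatFunc k) : RatFunc k :=
  algebraMap k[X] (RatFunc k) (derivative f.num * f.denom - f.num * derivative f.denom) /
    algebraMap k[X] (RatFunc k) f.denom ^ 2

/-- `f` is regular at the finite point `a`. -/
def RegularAt (a : k) (f : RatFunc k) : Prop := f.denom.eval a ≠ 0

/-- The value at `a` of a rational function that is regular at `a`. -/
def valueAt (a : k) (f : RatFunc k) : k := f.eval (RingHom.id k) a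

/-- `f` is regular at infinity. -/
def RegularAtInfty (f : RatFunc k) : Prop := f.num.natDegree ≤ f.denom.natDegree

/-- The value at infinity of a rational function that is regular at infinity. -/
def valueAtInfty (f : RatFunc k) : k :=
  f.num.coeff f.denom.natDegree / f.denom.leadingCoeff

/-- The standard local parameter at a point of the projective line over `k`: it is `x - a` at the
finite point `a`, and `1 / x` at infinity. -/
def localParam : OnePoint k → RatFunc k :=
  fun P => P.elim (RatFunc.X)⁻¹ (fun a => RatFunc.X - RatFunc.C a)

end RationalFunctions

/-! ### Second order differential operators -/

/-- The operator `L = (d/dx)² + p₁ (d/dx) + p₂` with rational coefficients. -/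
structure DiffOp (k : Type*) [Field k] where
  p₁ : RatFunc k
  p₂ : RatFunc k

namespace DiffOp

variable {k : Type*} [Field k] (L : DiffOp k)

/-- `L` applied to a polynomial. -/
def app (w : k[X]) : RatFunc k :=
  algebraMap k[X] (RatFunc k) (derivative (derivative w)) +
    L.p₁ * algebraMap k[X] (RatFunc k) (derivative w) + L.p₂ * algebraMap k[X] (RatFunc k) w

/-- The first order operator `L_W = d/dx + p₁` applied to a polynomial. -/
def wronskianApp (w : k[X]) : RatFunc k :=
  algebraMap k[X] (RatFunc k) (derivative w) + L.p₁ * algebraMap k[X] (RatFunc k) w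

/-- `L` is Fuchsian with singularities in the finite points of `S` and infinity: `p₁` and `p₂` are
regular at all other points, `pᵢ` has a pole of order at most `i` at the points of `S`, and `pᵢ`
vanishes to order at least `i` at infinity. -/
structure IsFuchsian (S : Set k) : Prop where
  regular : ∀ a, a ∉ S → RegularAt a L.p₁ ∧ RegularAt a L.p₂
  pole : ∀ a ∈ S, RegularAt a (localParam (a : OnePoint k) * L.p₁) ∧
    RegularAt a (localParam (a : OnePoint k) ^ 2 * L.p₂)
  infty : RegularAtInfty (RatFunc.X * L.p₁) ∧ RegularAtInfty (RatFunc.X ^ 2 * L.p₂)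

/-- `{α, β}` are the local exponents of `L` at the finite point `a`, i.e. the roots of the indicial
equation. -/
def HasExponentsAt (a α β : k) : Prop :=
  α + β = 1 - valueAt a (localParam (a : OnePoint k) * L.p₁) ∧
    α * β = valueAt a (localParam (a : OnePoint k) ^ 2 * L.p₂)

/-- `{α, β}` are the local exponents of `L` at infinity. -/
def HasExponentsAtInfty (α β : k) : Prop :=
  α + β = -1 + valueAtInfty (RatFunc.X * L.p₁) ∧
    α * β = valueAtInfty (RatFunc.X ^ 2 * L.p₂)

/-- Nilpotent `p`-curvature: `L` and `L_W` both have a (nonzero) polynomial solution. -/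
def NilpotentPCurvature : Prop :=
  (∃ w : k[X], w ≠ 0 ∧ L.app w = 0) ∧ (∃ w : k[X], w ≠ 0 ∧ L.wronskianApp w = 0)

/-- `w` is a monic polynomial solution of `L` of minimal degree. -/
def IsMinimalSolution (w : k[X]) : Prop :=
  w.Monic ∧ L.app w = 0 ∧ ∀ v : k[X], v ≠ 0 → L.app v = 0 → w.natDegree ≤ v.natDegree

/-- `L` (with finite singularities `S`) is normalized: it has nilpotent `p`-curvature, and its
unique monic solution of minimal degree does not vanish at the singularities. -/
def IsNormalized (S : Set k) : Prop :=
  L.NilpotentPCurvature ∧ ∃ w : k[X], L.IsMinimalSolution w ∧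
    (∀ v, L.IsMinimalSolution v → v = w) ∧ ∀ a ∈ S, w.eval a ≠ 0

section Solutions

variable (p : ℕ) [Fact p.Prime] [CharP k p]

/-- The ring `k[x]^p` of `p`-th powers of polynomials. -/
abbrev pPowers (k : Type*) [Field k] (p : ℕ) [Fact p.Prime] [CharP k p] : Subring k[X] :=
  (frobenius k[X] p).range

theorem derivative_pPowers_mul (c : pPowers k p) (w : k[X]) :
    derivative ((c : k[X]) * w) = (c : k[X]) * derivative w := by
  obtain ⟨_, f, rfl⟩ := c
  simp [frobenius_def, derivative_pow]

/-- The `k[x]^p`-module of polynomial solutions of `L`. -/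
def polySolutions : Submodule (pPowers k p) k[X] where
  carrier := {w | L.app w = 0}
  zero_mem' := by simp [app]
  add_mem' := by
    intro v w hv hw
    have h : L.app (v + w) = L.app v + L.app w := by simp only [app, map_add]; ring
    simp only [Set.mem_ofPred_eq] at *
    rw [h, hv, hw, add_zero]
  smul_mem' := by
    intro c w hw
    have h : L.app (c • w) = algebraMap k[X] (RatFunc k) c * L.app w := by
      simp only [app, Subring.smul_def, smul_eq_mul, derivative_pPowers_mul, map_mul]; ring
    simp only [Set.mem_ofPred_eq] at *
    rw [h, hw, mul_zero]

/-- Nonzero `p`-curvature (for `L` with nilpotent `p`-curvature): the space of polynomial solutions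
is one-dimensional over `k[x]^p`. -/
def NonzeroPCurvature : Prop := Module.rank (pPowers k p) (L.polySolutions p) = 1

end Solutions

end DiffOp

/-! ### Galois covers of the projective line

A smooth projective curve `Z` over `k` with a finite Galois cover `Z → ℙ¹` is given by its function
field `K`, a finite Galois extension of `k(x)`.  Its closed points are the valuation rings of `K`
over `k` other than `K`, its meromorphic differentials are the Kähler differentials `Ω[K⁄k]`, and
the Galois group is `H = Gal(K / k(x))`. -/

section Covers

variable {k K : Type*} [Field k] [Field K] [Algebra k K]

/-- The automorphism `β` of `K`, viewed as a `K`-algebra structure on (a copy of) `K`. -/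
def Twist (_β : K ≃ₐ[k] K) : Type _ := K

instance (β : K ≃ₐ[k] K) : Field (Twist β) := inferInstanceAs (Field K)
instance (β : K ≃ₐ[k] K) : Algebra k (Twist β) := inferInstanceAs (Algebra k K)
instance (β : K ≃ₐ[k] K) : Algebra K (Twist β) := β.toRingEquiv.toRingHom.toAlgebra
instance (β : K ≃ₐ[k] K) : IsScalarTower k K (Twist β) :=
  IsScalarTower.of_algebraMap_eq fun c => (β.commutes c).symm

/-- Pullback of differentials along `β`: `f dg ↦ β(f) d(β(g))`. -/
def pullback (β : K ≃ₐ[k] K) (η : Ω[K⁄k]) : Ω[K⁄k] :=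
  (KaehlerDifferential.map k k K (Twist β) η : Ω[Twist β⁄k])

theorem pullback_add (β : K ≃ₐ[k] K) (η θ : Ω[K⁄k]) :
    pullback β (η + θ) = pullback β η + pullback β θ :=
  map_add (KaehlerDifferential.map k k K (Twist β)) η θ

theorem pullback_smul_D (β : K ≃ₐ[k] K) (f g : K) :
    pullback β (f • D k K g) = β f • D k K (β g) := by
  have h : KaehlerDifferential.map k k K (Twist β) (f • D k K g) =
      (algebraMap K (Twist β) f) • D k (Twist β) (algebraMap K (Twist β) g) := by
    rw [map_smul, KaehlerDifferential.map_D, algebraMap_smul]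
  exact h

/-- `η` has order `n` at the point `z`: `η = v tⁿ dt` with `t` a uniformizer at `z` (a generator of
the maximal ideal) and `v` a unit at `z`. -/
def HasOrderAt (z : ValuationSubring K) (η : Ω[K⁄k]) (n : ℤ) : Prop :=
  ∃ t v : K, t ≠ 0 ∧ (∀ y : K, y ∈ z.nonunits ↔ ∃ c ∈ z, y = c * t) ∧
    v ∈ z ∧ v⁻¹ ∈ z ∧ v ≠ 0 ∧ η = (v * t ^ n) • D k K t

open Classical in
/-- The order `ord_z(η)` at the point `z` of a nonzero meromorphic differential `η`. -/
def ordAt (z : ValuationSubring K) (η : Ω[K⁄k]) : ℤ :=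
  if h : ∃ n, HasOrderAt z η n then h.choose else 0

variable [Algebra (RatFunc k) K]

/-- `z` is a point of `Z` above the point `P` of the projective line: a valuation ring of `K` that
contains `k` and in whose maximal ideal the local parameter at `P` lies. -/
def LiesAbove (z : ValuationSubring K) (P : OnePoint k) : Prop :=
  (∀ c : k, algebraMap k K c ∈ z) ∧ algebraMap (RatFunc k) K (localParam P) ∈ z.nonunits

theorem localParam_transcendental (P : OnePoint k) : Transcendental k (localParam P) := by
  intro h
  refine RatFunc.transcendental_X (K := k) ?_
  induction P using OnePoint.rec with
  | infty =>
    have h' : IsAlgebraic k ((RatFunc.X : RatFunc k)⁻¹) := h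
    simpa using h'.inv
  | coe a =>
    have h' : IsAlgebraic k (RatFunc.X - RatFunc.C a : RatFunc k) := h
    have h2 := h'.add (isAlgebraic_algebraMap (R := k) (A := RatFunc k) a)
    simpa [RatFunc.algebraMap_eq_C] using h2

theorem exists_liesAbove [IsScalarTower k (RatFunc k) K] (P : OnePoint k) :
    ∃ z : ValuationSubring K, LiesAbove z P := by
  set t : K := algebraMap (RatFunc k) K (localParam P) with ht
  have htr : Transcendental k t :=
    (transcendental_algebraMap_iff (algebraMap (RatFunc k) K).injective).2
      (localParam_transcendental P)
  have htA : t ∈ Algebra.adjoin k {t} := Algebra.self_mem_adjoin_singleton k t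
  obtain ⟨z, hz, hI⟩ := Ideal.image_subset_nonunits_valuationSubring
    (A := (Algebra.adjoin k {t}).toSubring) (Ideal.span {⟨t, htA⟩}) (by
      intro h
      rw [Ideal.eq_top_iff_one, Ideal.mem_span_singleton'] at h
      obtain ⟨⟨c, hc⟩, h⟩ := h
      have h1 : c * t = 1 := congrArg Subtype.val h
      obtain ⟨q, rfl⟩ := (Algebra.adjoin_singleton_eq_range_aeval k t) ▸ hc
      refine htr ⟨q * X - 1, ?_, ?_⟩
      · intro h0
        have := congrArg (Polynomial.eval 0) h0
        simp at this
      · simpa [sub_eq_zero] using h1)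
  refine ⟨z, fun c => hz (Subalgebra.algebraMap_mem _ c), hI ?_⟩
  exact ⟨⟨t, htA⟩, Ideal.subset_span rfl, rfl⟩

end Covers

/-! ### Deformation data -/

/-- A deformation datum: a finite Galois cover `Z → ℙ¹` (given by the extension `K / k(x)`) with
group `H`, an injective character `χ : H → 𝔽_pˣ`, and a meromorphic differential `ω` on `Z` which
is logarithmic (and nonzero), with `β^* ω = χ(β) ω` for all `β ∈ H`. -/
structure DeformationDatum (p : ℕ) (k K : Type*) [Fact p.Prime] [Field k] [CharP k p] [Field K]
    [Algebra k K] [Algebra (RatFunc k) K] [IsScalarTower k (RatFunc k) K] where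
  χ : (K ≃ₐ[RatFunc k] K) →* (ZMod p)ˣ
  χ_injective : Function.Injective χ
  ω : Ω[K⁄k]
  ω_ne_zero : ω ≠ 0
  equivariant : ∀ β : K ≃ₐ[RatFunc k] K,
    pullback (β.restrictScalars k) ω = (ZMod.castHom (dvd_refl p) k (χ β : ZMod p)) • ω
  logarithmic : ∃ f : K, f ≠ 0 ∧ ω = f⁻¹ • D k K f

namespace DeformationDatum

variable {p : ℕ} {k K : Type*} [Fact p.Prime] [Field k] [CharP k p] [Field K]
  [Algebra k K] [Algebra (RatFunc k) K] [IsScalarTower k (RatFunc k) K]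
  (Δ : DeformationDatum p k K)

/-- Some point of `Z` above `P`. -/
def pointAbove (K : Type*) [Field K] [Algebra k K] [Algebra (RatFunc k) K]
    [IsScalarTower k (RatFunc k) K] (P : OnePoint k) : ValuationSubring K :=
  (exists_liesAbove P).choose

/-- `m_P = |H_z|`, the order of the stabilizer of a point `z` above `P`. -/
def m (_Δ : DeformationDatum p k K) (P : OnePoint k) : ℕ :=
  Nat.card ((pointAbove K P).decompositionSubgroup (RatFunc k))

/-- `h_P = ord_z(ω) + 1` for a point `z` above `P`. -/
def h (P : OnePoint k) : ℤ := ordAt (pointAbove K P) Δ.ω + 1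

/-- The ramification invariant `σ_P = h_P / m_P`. -/
def σ (P : OnePoint k) : ℚ := Δ.h P / Δ.m P

/-- A critical point. -/
def IsCritical (P : OnePoint k) : Prop := Δ.σ P ≠ 1

/-- A supersingular point. -/
def IsSupersingular (P : OnePoint k) : Prop :=
  Δ.IsCritical P ∧ Δ.σ P = ((p : ℚ) + 1) / ((p : ℚ) - 1)

/-- A singularity: a critical point that is not supersingular, with `σ_P ≢ 1 (mod p)`. -/
def IsSingular (P : OnePoint k) : Prop :=
  Δ.IsCritical P ∧ ¬ Δ.IsSupersingular P ∧ (Δ.σ P : ZMod p) ≠ 1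

/-- The set of finite singularities `x_1, …, x_{r-1}` (if infinity is a singularity). -/
def finiteSingularities : Set k := {a | Δ.IsSingular (a : OnePoint k)}

/-- The number `r` of singularities. -/
def r : ℕ := {P | Δ.IsSingular P}.ncard

/-- The datum is trivial if `2 g - 2 + r = 0`, where `g = 0` is the genus of the projective line. -/
def IsTrivial : Prop := 2 * (0 : ℤ) - 2 + Δ.r = 0

/-- The integer `ν_P` in `σ_P = a_P / (p - 1) + ν_P`, `0 ≤ a_P < p - 1`. -/
def ν (P : OnePoint k) : ℤ := ⌊Δ.σ P⌋

/-- The integer `a_P` in `σ_P = a_P / (p - 1) + ν_P`, `0 ≤ a_P < p - 1`. -/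
def a (P : OnePoint k) : ℤ := ⌊((p : ℚ) - 1) * (Δ.σ P - Δ.ν P)⌋

/-- The defining property of `a_P` and `ν_P`. -/
theorem σ_eq (P : OnePoint k) :
    Δ.σ P = Δ.a P / ((p : ℚ) - 1) + Δ.ν P ∧ 0 ≤ Δ.a P ∧ Δ.a P < p - 1 := by
  have hp : 2 ≤ p := (Fact.out : p.Prime).two_le
  have hp' : (0 : ℚ) < (p : ℚ) - 1 := by
    have : (2 : ℚ) ≤ p := by exact_mod_cast hp
    linarith
  have hfin : Finite (K ≃ₐ[RatFunc k] K) := Finite.of_injective _ Δ.χ_injective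
  have hdvd : Δ.m P ∣ p - 1 := by
    refine (Subgroup.card_subgroup_dvd_card _).trans ?_
    have := Subgroup.card_dvd_of_injective Δ.χ Δ.χ_injective
    rwa [Nat.card_eq_fintype_card (α := (ZMod p)ˣ), ZMod.card_units] at this
  obtain ⟨e, he⟩ := hdvd
  have hm : (Δ.m P : ℚ) ≠ 0 := by
    have : Δ.m P ≠ 0 := by rintro h0; rw [h0] at he; omega
    exact_mod_cast this
  have he' : (p : ℚ) - 1 = Δ.m P * e := by
    have : ((p - 1 : ℕ) : ℚ) = (Δ.m P * e : ℕ) := by rw [he]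
    rw [Nat.cast_sub (by omega)] at this
    exact_mod_cast this
  have hint : ((p : ℚ) - 1) * (Δ.σ P - Δ.ν P) =
      ((Δ.h P * e - (p - 1) * Δ.ν P : ℤ) : ℚ) := by
    have : ((p : ℚ) - 1) * Δ.σ P = Δ.h P * e := by
      rw [he', σ]; field_simp
    push_cast
    rw [mul_sub, this]
  have ha : (Δ.a P : ℚ) = ((p : ℚ) - 1) * (Δ.σ P - Δ.ν P) := by
    rw [a, hint, Int.floor_intCast]
  have h0 : 0 ≤ Δ.σ P - Δ.ν P := Int.fract_nonneg (Δ.σ P)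
  have h1 : Δ.σ P - Δ.ν P < 1 := Int.fract_lt_one (Δ.σ P)
  refine ⟨?_, ?_, ?_⟩
  · rw [ha]; field_simp; ring
  · have : (0 : ℚ) ≤ Δ.a P := by rw [ha]; positivity
    exact_mod_cast this
  · have : (Δ.a P : ℚ) < (p : ℚ) - 1 := by rw [ha]; nlinarith
    exact_mod_cast this

/-- The monic polynomial with simple zeros exactly at the (finite) supersingular points. -/
def u : k[X] := ∏ᶠ b ∈ {b : k | Δ.IsSupersingular (b : OnePoint k)}, (X - C b)

/-- `Q = ∏ (x - x_i) ^ (1 + a_i - ν_i)`, the product over the finite singularities. -/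
def Q : RatFunc k :=
  ∏ᶠ b ∈ Δ.finiteSingularities,
    localParam (b : OnePoint k) ^ (1 + Δ.a (b : OnePoint k) - Δ.ν (b : OnePoint k))

/-- The operator `(d/dx)² + (Q' / Q) (d/dx) + P₂ / ∏ (x - x_i)`. -/
def operator (P₂ : k[X]) : DiffOp k where
  p₁ := ratDeriv Δ.Q / Δ.Q
  p₂ := algebraMap k[X] (RatFunc k) P₂ /
    ∏ᶠ b ∈ Δ.finiteSingularities, localParam (b : OnePoint k)

end DeformationDatum

end DefData

end

/-! Write `ω = g dx`. The characters take values in `𝔽_pˣ`, so `G = g ^ (p - 1)` is invariant under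
the Galois group and lies in `k(x)`. The ramification is tame because `m_P` divides `p - 1`;
comparing valuations on `K` with those on `k(x)` then shows that `G` has order `n_b = (p - 1)(σ_b -
1)` at each finite `b`, and its degree gives `σ_∞`. By Jacobson's formula a logarithmic `g dx`
satisfies `δ^(p-1) g = -g ^ p`. As `g = g ^ p / G` and `p`-th powers are constants for `δ`, this
becomes `D^(p-1)(1 / G) = -1`. Both facts form `DeformationDatum.exists_divisor`; from there on only
`k(x)` occurs.

Supersingular means `n_b = 2`, and singular means `n_b ≠ 2` and `p ∤ n_b`. Multiplying `1 / G` by a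
`p`-th power `h ^ p` gives the polynomial `F = u ^ (p - 2) Z`, where `Z` has exponents `≡ -n_b` at
the finite singularities, and `D^(p-1) F = -h ^ p`. Here `h ≠ 0` has a simple zero at each
supersingular point (`iterate_derivative_of_iterate_ratDeriv`). Let `N` be the product of the `x -
x_i` and `M / N = Z' / Z`; since `Q Z` is a `p`-th power, `Q' / Q = -M / N`.

The vanishing of `D^(p-1) F` at the zeros of `u` says exactly that `u` divides `N u'' - M u'`; the
quotient is `-P₂`, and comparing top coefficients gives its degree and leading term
(`exists_fuchsian_equation`). That `D^(p-1) F` is not zero forces every polynomial solution to be a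
`p`-th power times `u`, by a Wronskian argument (`Polynomial.exists_eq_pow_mul_of_wronskian`). This
gives the nonzero `p`-curvature, the minimality of `u`, and even `r ≠ 1`. -/

/-! ### Valuation rings of Galois extensions and primes of Dedekind domains. -/

section ValuationExtension

open IsDedekindDomain WithZero Pointwise

variable {A B F K : Type*} [CommRing A] [IsDedekindDomain A] [CommRing B] [IsDedekindDomain B]
  [Field F] [Field K] [Algebra A F] [IsFractionRing A F] [Algebra F K] [Algebra A K]
  [IsScalarTower A F K] [Algebra A B] [Algebra B K] [IsFractionRing B K] [IsScalarTower A B K]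

/-- A discrete valuation ring is maximal among the proper subrings of its fraction field. The
localization at `w` lies in `z`, because elements outside `w` become units there, and a nonzero
element of `w` shows `z ≠ K`. -/
theorem HeightOneSpectrum.valuationSubring_eq_of_mem_iff (w : HeightOneSpectrum B)
    (z : ValuationSubring K) (hB : ∀ b : B, algebraMap B K b ∈ z)
    (hw : ∀ b : B, b ∈ w.asIdeal ↔ algebraMap B K b ∈ z.nonunits) :
    (w.valuation K).valuationSubring = z := by
  rw [← HeightOneSpectrum.valuationSubringAtPrime_eq_valuationSubring]
  refine ValuationSubring.eq_of_le_of_ne_top _ ?_ ?_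
  · rintro x ⟨a, s, hs, rfl⟩
    refine mul_mem (hB a) ?_
    by_contra hc
    refine hs ((hw s).2 ?_)
    rw [ValuationSubring.mem_nonunits_iff_or]
    exact Or.inr hc
  · rintro rfl
    obtain ⟨b, hb, hb0⟩ := Submodule.exists_mem_ne_zero_of_ne_bot w.ne_bot
    have := (hw b).1 hb
    rw [ValuationSubring.mem_nonunits_iff_or] at this
    simp at this
    exact hb0 this

/-- The ring and the prime determine each other: `w` consists of the elements of `B` that are
nonunits of `z`, and elements of `z` are fractions with denominator outside `w`. This carries the
ramification theory of primes over to `decompositionSubgroup`. -/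
theorem HeightOneSpectrum.stabilizer_eq (G : Type*) [Group G] [MulSemiringAction G B]
    [MulSemiringAction G K] (hG : ∀ (g : G) (b : B), algebraMap B K (g • b) = g • algebraMap B K b)
    (w : HeightOneSpectrum B) (z : ValuationSubring K)
    (hz : (w.valuation K).valuationSubring = z) :
    MulAction.stabilizer G z = MulAction.stabilizer G w.asIdeal := by
  have hB : ∀ b : B, algebraMap B K b ∈ z := fun b => hz ▸ w.valuation_le_one b
  have hw : ∀ b : B, b ∈ w.asIdeal ↔ algebraMap B K b ∈ z.nonunits := by
    intro b
    rw [← HeightOneSpectrum.valuation_lt_one_iff_mem (K := K), ValuationSubring.mem_nonunits_iff]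
    subst hz
    exact (Valuation.isEquiv_valuation_valuationSubring _).lt_one_iff_lt_one
  have hz_iff : ∀ g : G, g • z = z ↔ ∀ x : K, g • x ∈ z ↔ x ∈ z := by
    refine fun g => ⟨fun h x => ?_, fun h => ?_⟩
    · conv_lhs => rw [← h]
      exact ValuationSubring.smul_mem_pointwise_smul_iff
    · ext y
      rw [ValuationSubring.mem_pointwise_smul_iff_inv_smul_mem, ← h, smul_inv_smul]
  have hw_iff : ∀ g : G, g • w.asIdeal = w.asIdeal ↔ ∀ b : B, g • b ∈ w.asIdeal ↔ b ∈ w.asIdeal := by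
    refine fun g => ⟨fun h x => ?_, fun h => ?_⟩
    · conv_lhs => rw [← h]
      exact Ideal.smul_mem_pointwise_smul_iff
    · ext y
      rw [Ideal.mem_pointwise_smul_iff_inv_smul_mem, ← h, smul_inv_smul]
  ext g
  rw [MulAction.mem_stabilizer_iff, MulAction.mem_stabilizer_iff, hz_iff, hw_iff]
  constructor
  · intro h b
    rw [hw, hw, hG, ValuationSubring.mem_nonunits_iff_or, ValuationSubring.mem_nonunits_iff_or,
      ← smul_inv'', h, smul_eq_zero_iff_eq]
  · intro h
    have key : ∀ g : G, (∀ b : B, g • b ∈ w.asIdeal ↔ b ∈ w.asIdeal) → ∀ x : K, x ∈ z → g • x ∈ z := by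
      intro g h x hx
      subst hz
      obtain ⟨n, d, hnd⟩ := w.exists_primeCompl_mul_eq_of_integer x hx
      have h1 : (g • x) * algebraMap B K (g • (d : B)) = algebraMap B K (g • n) := by
        rw [hG, hG, ← smul_mul', hnd]
      have h2 : w.valuation K (algebraMap B K (g • (d : B))) = 1 := by
        rw [HeightOneSpectrum.valuation_eq_one_iff_notMem]
        exact fun h' => d.2 ((h _).1 h')
      have h3 := congrArg (w.valuation K) h1
      rw [map_mul, h2, mul_one] at h3
      change w.valuation K (g • x) ≤ 1
      rw [h3]
      exact w.valuation_le_one _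
    refine fun x => ⟨fun hx => ?_, key g h x⟩
    have := key g⁻¹ (fun b => by rw [← h, smul_inv_smul]) _ hx
    rwa [inv_smul_smul] at this

/-- A valuation ring of a Galois extension that lies over a height one prime of a Dedekind domain
`A` with algebraically closed residue field `k`: it is the valuation ring of a discrete valuation,
its residue field is `k`, and its ramification index is the order of its decomposition group. -/
theorem ValuationSubring.exists_heightOneSpectrum (k : Type*) [Field k] [IsAlgClosed k]
    [Algebra k A] [Algebra k B] [IsScalarTower k A B] [Module.Finite A B]
    [FiniteDimensional F K] [IsGalois F K] [MulSemiringAction (K ≃ₐ[F] K) B]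
    (hG : ∀ (g : K ≃ₐ[F] K) (b : B), algebraMap B K (g • b) = g • algebraMap B K b)
    (v : HeightOneSpectrum A) (hk : ∀ a : A, ∃ c : k, a - algebraMap k A c ∈ v.asIdeal)
    (z : ValuationSubring K) (hAz : ∀ a : A, algebraMap A K a ∈ z)
    (hvz : ∀ a ∈ v.asIdeal, algebraMap A K a ∈ z.nonunits) :
    ∃ w : HeightOneSpectrum B, (w.valuation K).valuationSubring = z ∧
      (∀ b : B, ∃ c : k, b - algebraMap k B c ∈ w.asIdeal) ∧
      ∀ y : F, w.valuation K (algebraMap F K y) =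
        v.valuation F y ^ Nat.card (z.decompositionSubgroup F) := by
  classical
  have hB : ∀ b : B, algebraMap B K b ∈ z := by
    intro b
    have h : IsIntegral A (algebraMap B K b) := (Algebra.IsIntegral.isIntegral b).algebraMap
    have h2 : IsIntegral z (algebraMap B K b) := by
      obtain ⟨q, hq, hq0⟩ := h
      refine ⟨q.map ((algebraMap A K).codRestrict z hAz), hq.map _, ?_⟩
      rw [Polynomial.eval₂_map]
      exact hq0
    obtain ⟨y, hy⟩ := IsIntegrallyClosed.isIntegral_iff.1 h2
    exact hy ▸ y.2
  let φ : B →+* z := (algebraMap B K).codRestrict z hB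
  let P : Ideal B := (IsLocalRing.maximalIdeal z).comap φ
  have hPmem : ∀ b : B, b ∈ P ↔ algebraMap B K b ∈ z.nonunits := fun b =>
    (ValuationSubring.coe_mem_nonunits_iff (A := z) (a := φ b)).symm
  have hPp : P.IsPrime := Ideal.comap_isPrime φ _
  have hover : P.LiesOver v.asIdeal := by
    constructor
    refine v.isMaximal.eq_of_le (Ideal.IsPrime.ne_top (hPp.comap (algebraMap A B))) ?_
    intro a ha
    change algebraMap A B a ∈ P
    rw [hPmem, ← IsScalarTower.algebraMap_apply]
    exact hvz a ha
  have htor : Module.IsTorsionFree A B := by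
    have : FaithfulSMul A B := by
      rw [faithfulSMul_iff_algebraMap_injective]
      have h : Function.Injective (algebraMap A K) := by
        rw [IsScalarTower.algebraMap_eq A F K]
        exact (algebraMap F K).injective.comp (IsFractionRing.injective A F)
      rw [IsScalarTower.algebraMap_eq A B K] at h
      exact Function.Injective.of_comp h
    infer_instance
  have hPbot : P ≠ ⊥ := by
    obtain ⟨a, ha, ha0⟩ := Submodule.exists_mem_ne_zero_of_ne_bot v.ne_bot
    intro h
    have h1 : algebraMap A B a ∈ P := by
      rw [hPmem, ← IsScalarTower.algebraMap_apply]
      exact hvz a ha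
    rw [h, Ideal.mem_bot, FaithfulSMul.algebraMap_eq_zero_iff] at h1
    exact ha0 h1
  let w : HeightOneSpectrum B := ⟨P, hPp, hPbot⟩
  have hover' : w.asIdeal.LiesOver v.asIdeal := hover
  have hwz : (w.valuation K).valuationSubring = z :=
    HeightOneSpectrum.valuationSubring_eq_of_mem_iff w z hB hPmem
  have hvmax : v.asIdeal.IsMaximal := v.isMaximal
  have hPmax : P.IsMaximal := w.isMaximal
  have hsurjA : Function.Surjective (algebraMap k (A ⧸ v.asIdeal)) := by
    intro y
    obtain ⟨a, rfl⟩ := Ideal.Quotient.mk_surjective y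
    obtain ⟨c, hc⟩ := hk a
    exact ⟨c, ((Ideal.Quotient.mk_eq_mk_iff_sub_mem _ _).2 hc).symm⟩
  have hst : IsScalarTower k (A ⧸ v.asIdeal) (B ⧸ P) := IsScalarTower.of_algebraMap_eq fun c => by
    change Ideal.Quotient.mk P (algebraMap k B c) =
      Ideal.Quotient.mk P (algebraMap A B (algebraMap k A c))
    rw [← IsScalarTower.algebraMap_apply]
  have hkA : Algebra.IsIntegral k (A ⧸ v.asIdeal) :=
    ⟨fun x => by obtain ⟨c, rfl⟩ := hsurjA x; exact isIntegral_algebraMap⟩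
  have hkB : Algebra.IsIntegral k (B ⧸ P) := Algebra.IsIntegral.trans (A ⧸ v.asIdeal)
  have hbijB : Function.Bijective (algebraMap k (B ⧸ P)) :=
    IsAlgClosed.algebraMap_bijective_of_isIntegral
  have hres : ∀ b : B, ∃ c : k, b - algebraMap k B c ∈ P := by
    intro b
    obtain ⟨c, hc⟩ := hbijB.2 (Ideal.Quotient.mk P b)
    exact ⟨c, (Ideal.Quotient.mk_eq_mk_iff_sub_mem _ _).1 hc.symm⟩
  refine ⟨w, hwz, hres, ?_⟩
  have hdist : SMulDistribClass (K ≃ₐ[F] K) B K := by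
    refine ⟨fun g b x => ?_⟩
    rw [Algebra.smul_def, smul_mul', Algebra.smul_def, hG]
  have hgal : IsGaloisGroup (K ≃ₐ[F] K) A B := IsGaloisGroup.of_isFractionRing _ A B F K
  have hperf : PerfectField v.asIdeal.ResidueField := by
    have h : Function.Bijective
        ((algebraMap (A ⧸ v.asIdeal) v.asIdeal.ResidueField).comp
          (algebraMap k (A ⧸ v.asIdeal))) :=
      ⟨RingHom.injective _,
        (Ideal.bijective_algebraMap_quotient_residueField v.asIdeal).2.comp hsurjA⟩
    exact PerfectField.of_ringEquiv (RingEquiv.ofBijective _ h)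
  have hdeg : P.inertiaDeg A = 1 := by
    rw [Ideal.inertiaDeg_eq_of_isMaximal v.asIdeal P]
    let := Ideal.Quotient.field v.asIdeal
    refine finrank_eq_one (1 : B ⧸ P) one_ne_zero fun y => ?_
    obtain ⟨c, rfl⟩ := hbijB.2 y
    refine ⟨algebraMap k (A ⧸ v.asIdeal) c, ?_⟩
    rw [IsScalarTower.algebraMap_apply k (A ⧸ v.asIdeal) (B ⧸ P)]
    exact (Algebra.algebraMap_eq_smul_one _).symm
  -- The stabilizer has order `e f`, and `f = 1` because both residue fields are `k`.
  have hcard : Nat.card (z.decompositionSubgroup F) = v.asIdeal.ramificationIdx' P := by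
    rw [ValuationSubring.decompositionSubgroup, HeightOneSpectrum.stabilizer_eq _ hG w z hwz,
      Ideal.card_stabilizer_eq v.asIdeal w.asIdeal, 
      Ideal.ramificationIdxIn_eq_ramificationIdx v.asIdeal P (K ≃ₐ[F] K),
      Ideal.inertiaDegIn_eq_inertiaDeg v.asIdeal P (K ≃ₐ[F] K), hdeg, mul_one,
      Ideal.ramificationIdx'_eq_ramificationIdx _ _ v.ne_bot]
  intro y
  rw [hcard]
  exact (HeightOneSpectrum.valuation_liesOver K v w y).symm

end ValuationExtension


/-! ### The discrete valuation at a place, and a bound for derivations. -/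

section LocalParameter

open IsDedekindDomain WithZero Polynomial

theorem Valuation.exists_forall_le_exp {K ι : Type*} [Field K] (w : Valuation K ℤᵐ⁰)
    (S : Finset ι) (f : ι → K) : ∃ N : ℤ, ∀ x ∈ S, w (f x) ≤ exp N := by
  classical
  induction S using Finset.induction_on with
  | empty => exact ⟨0, by simp⟩
  | insert a S ha ih =>
    obtain ⟨N, hN⟩ := ih
    refine ⟨max N (log (w (f a))), ?_⟩
    intro x hx
    rcases Finset.mem_insert.1 hx with rfl | hx
    · by_cases h0 : w (f x) = 0
      · rw [h0]; exact zero_le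
      · conv_lhs => rw [← exp_log h0]
        exact exp_le_exp.2 (le_max_right _ _)
    · exact (hN x hx).trans (exp_le_exp.2 (le_max_left _ _))

/-- Finitely many generators of `B` over `A` and the Leibniz rule bound `δ` on `B`; the quotient
rule with unit denominators extends the bound to the local ring. The bound is crude, but
`Valuation.derivation_le` sharpens any such bound. -/
theorem HeightOneSpectrum.exists_forall_derivation_le {k A B K : Type*} [CommRing k] [CommRing A]
    [CommRing B] [IsDedekindDomain B] [Field K] [Algebra k K] [Algebra A B] [Algebra B K]
    [Algebra A K] [IsScalarTower A B K] [IsFractionRing B K] [Module.Finite A B]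
    (w : HeightOneSpectrum B) (δ : Derivation k K K) {N₂ : ℤ}
    (hA : ∀ a : A, w.valuation K (δ (algebraMap A K a)) ≤ exp N₂) :
    ∃ N : ℤ, ∀ y, w.valuation K y ≤ 1 → w.valuation K (δ y) ≤ exp N := by
  obtain ⟨S, hS⟩ := (inferInstance : Module.Finite A B).fg_top
  obtain ⟨N₁, hN₁⟩ := (w.valuation K).exists_forall_le_exp S (fun b => δ (algebraMap B K b))
  have hB : ∀ b : B, w.valuation K (δ (algebraMap B K b)) ≤ exp (max N₁ N₂) := by
    intro b
    have hb : b ∈ Submodule.span A (S : Set B) := hS ▸ trivial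
    induction hb using Submodule.span_induction with
    | mem x hx => exact (hN₁ x hx).trans (exp_le_exp.2 (le_max_left _ _))
    | zero => simp
    | add x y _ _ hx hy =>
      rw [map_add, map_add]
      exact (Valuation.map_add _ _ _).trans (max_le hx hy)
    | smul a x _ hx =>
      rw [Algebra.smul_def, map_mul, ← IsScalarTower.algebraMap_apply, Derivation.leibniz,
        smul_eq_mul, smul_eq_mul]
      refine (Valuation.map_add _ _ _).trans (max_le ?_ ?_)
      · rw [map_mul, IsScalarTower.algebraMap_apply A B K]
        exact (mul_le_of_le_one_left' (w.valuation_le_one _)).trans hx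
      · rw [map_mul]
        exact (mul_le_of_le_one_left' (w.valuation_le_one _)).trans
          ((hA a).trans (exp_le_exp.2 (le_max_right _ _)))
  refine ⟨max N₁ N₂, fun y hy => ?_⟩
  obtain ⟨n, d, hnd⟩ := w.exists_primeCompl_mul_eq_of_integer y hy
  have hd : w.valuation K (algebraMap B K d) = 1 :=
    (HeightOneSpectrum.valuation_eq_one_iff_notMem _).2 d.2
  have h1 : δ y * algebraMap B K d = δ (algebraMap B K n) - y * δ (algebraMap B K d) := by
    rw [← hnd, Derivation.leibniz, smul_eq_mul, smul_eq_mul]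
    ring
  have h2 := congrArg (w.valuation K) h1
  rw [map_mul, hd, mul_one] at h2
  rw [h2]
  refine (Valuation.map_sub _ _ _).trans (max_le (hB n) ?_)
  rw [map_mul]
  exact (mul_le_of_le_one_left' hy).trans (hB d)

variable {k F K : Type*} [Field k] [IsAlgClosed k] [Field F] [Field K] [Algebra k F] [Algebra F K]
  [Algebra k K] [IsScalarTower k F K] [FiniteDimensional F K] [IsGalois F K]

/-- The discrete valuation of a place of a Galois extension of a rational function field. -/
theorem ValuationSubring.exists_valuation_of_param {s : F} (hs : Transcendental k s)
    (hgen : ∀ y : F, ∃ P Q : k[X], y = aeval s P / aeval s Q) (z : ValuationSubring K)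
    (hkz : ∀ c : k, algebraMap k K c ∈ z) (hsz : algebraMap F K s ∈ z.nonunits) :
    ∃ w : Valuation K ℤᵐ⁰, w.valuationSubring = z ∧ (∃ t, w t = exp (-1)) ∧
      (∀ y, w y ≤ 1 → ∃ c : k, w (y - algebraMap k K c) < 1) ∧
      w (algebraMap F K s) = exp (-(Nat.card (z.decompositionSubgroup F) : ℤ)) ∧
      ∀ δ : Derivation k K K, ∃ N : ℤ, ∀ y, w y ≤ 1 → w (δ y) ≤ exp N := by
  -- Letting `X` act as `s` turns every place, including those at infinity, into one over the prime
  -- `(X)` of `k[X]`; `B` is the integral closure of `k[s]` in `K`.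
  let algF : Algebra k[X] F := (aeval s).toAlgebra
  let algK : Algebra k[X] K := ((algebraMap F K).comp (algebraMap k[X] F)).toAlgebra
  have : IsScalarTower k[X] F K := IsScalarTower.of_algebraMap_eq fun _ => rfl
  have : FaithfulSMul k[X] F := by
    rw [faithfulSMul_iff_algebraMap_injective]
    exact transcendental_iff_injective.1 hs
  have : IsFractionRing k[X] F := IsFractionRing.of_field _ _ fun y => by
    obtain ⟨P, Q, h⟩ := hgen y
    exact ⟨P, Q, h⟩
  have : IsDedekindDomain (integralClosure k[X] K) := integralClosure.isDedekindDomain k[X] F K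
  have : IsFractionRing (integralClosure k[X] K) K :=
    integralClosure.isFractionRing_of_finite_extension F K
  have : Module.Finite k[X] (integralClosure k[X] K) :=
    IsIntegralClosure.finite k[X] F K (integralClosure k[X] K)
  have : IsScalarTower k k[X] F := IsScalarTower.of_algebraMap_eq fun c => by
    change _ = aeval s (C c)
    rw [aeval_C]
  have : IsScalarTower k k[X] K := IsScalarTower.of_algebraMap_eq fun c => by
    rw [IsScalarTower.algebraMap_apply k[X] F K, IsScalarTower.algebraMap_apply k F K,
      IsScalarTower.algebraMap_apply k k[X] F]
  let v : HeightOneSpectrum k[X] := ⟨Ideal.span {X}, by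
    rw [Ideal.span_singleton_prime X_ne_zero]; exact prime_X, by simp⟩
  have hXK : algebraMap k[X] K X = algebraMap F K s := by
    rw [IsScalarTower.algebraMap_apply k[X] F K]
    congr 1
    exact aeval_X s
  have hAz : ∀ a : k[X], algebraMap k[X] K a ∈ z := by
    intro a
    induction a using Polynomial.induction_on' with
    | add p q hp hq => rw [map_add]; exact z.add_mem _ _ hp hq
    | monomial n c =>
      rw [← C_mul_X_pow_eq_monomial, map_mul, map_pow, hXK]
      refine z.mul_mem _ _ ?_ (pow_mem (z.nonunits_subset hsz) n)
      have := hkz c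
      rwa [IsScalarTower.algebraMap_apply k k[X] K] at this
  obtain ⟨w, hwz, hres, hval⟩ := ValuationSubring.exists_heightOneSpectrum
    (A := k[X]) (B := integralClosure k[X] K) (F := F) (K := K) k (fun g b => rfl) v
    (fun a => ⟨a.coeff 0, by
      change _ ∈ Ideal.span {X}
      rw [Ideal.mem_span_singleton, X_dvd_iff]
      simp⟩) z hAz
    (fun a ha => by
      obtain ⟨b, rfl⟩ := Ideal.mem_span_singleton.1 ha
      rw [map_mul, hXK, ValuationSubring.mem_nonunits_iff, map_mul]
      exact mul_lt_one_of_lt_of_le hsz ((z.valuation_le_one_iff _).2 (hAz b)))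
  refine ⟨w.valuation K, hwz, w.valuation_exists_uniformizer K, ?_, ?_, ?_⟩
  · intro y hy
    obtain ⟨a, ha⟩ := w.exists_valuation_sub_lt_of_integer hy 1
    obtain ⟨c, hc⟩ := hres a
    refine ⟨c, ?_⟩
    rw [← HeightOneSpectrum.valuation_lt_one_iff_mem (K := K)] at hc
    have h : y - algebraMap k K c = algebraMap _ K (a - algebraMap k _ c) -
        (algebraMap (integralClosure k[X] K) K a - y) := by
      rw [map_sub, ← IsScalarTower.algebraMap_apply k (integralClosure k[X] K) K]
      ring
    rw [h]
    exact (Valuation.map_sub _ _ _).trans_lt (max_lt hc (by simpa using ha))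
  · rw [hval]
    conv_lhs => rw [← aeval_X (R := k) s]
    change v.valuation F (algebraMap k[X] F X) ^ _ = _
    rw [HeightOneSpectrum.valuation_of_algebraMap,
      HeightOneSpectrum.intValuation_singleton _ X_ne_zero rfl, ← exp_nsmul]
    simp
  · intro δ
    obtain ⟨N₂, hN₂⟩ := (w.valuation K).exists_forall_le_exp {()} (fun _ => δ (algebraMap F K s))
    refine HeightOneSpectrum.exists_forall_derivation_le (A := k[X]) w δ (N₂ := N₂) fun a => ?_
    have h1 : ∀ q : k[X], algebraMap k[X] K q = aeval (algebraMap F K s) q := by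
      intro q
      rw [IsScalarTower.algebraMap_apply k[X] F K, aeval_algebraMap_apply]
      rfl
    have h : δ (algebraMap k[X] K a) =
        algebraMap k[X] K (derivative a) * δ (algebraMap F K s) := by
      rw [h1, h1, ← smul_eq_mul, Derivation.map_aeval]
    rw [h, map_mul, IsScalarTower.algebraMap_apply k[X] (integralClosure k[X] K) K]
    exact (mul_le_of_le_one_left' (w.valuation_le_one _)).trans (hN₂ () (by simp))

end LocalParameter


/-! ### Differentials of a separable extension of `k(x)`. -/

section Differentials

open KaehlerDifferential Polynomial TensorProduct

/-- The extension of `d/dx` to a separable extension `K` of `k(x)`. -/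
theorem RatFunc.exists_derivation (k K : Type*) [Field k] [Field K] [Algebra k K]
    [Algebra (RatFunc k) K] [IsScalarTower k (RatFunc k) K] [Algebra.IsSeparable (RatFunc k) K] :
    ∃ δ : Derivation k K K, δ (algebraMap (RatFunc k) K RatFunc.X) = 1 ∧
      ∀ y, D k K y = δ y • D k K (algebraMap (RatFunc k) K RatFunc.X) := by
  let algK : Algebra k[X] K := ((algebraMap (RatFunc k) K).comp (algebraMap k[X] (RatFunc k))).toAlgebra
  have : IsScalarTower k[X] (RatFunc k) K := IsScalarTower.of_algebraMap_eq fun _ => rfl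
  have : IsScalarTower k k[X] K := IsScalarTower.of_algebraMap_eq fun c => by
    rw [IsScalarTower.algebraMap_apply k[X] (RatFunc k) K,
      IsScalarTower.algebraMap_apply k (RatFunc k) K,
      IsScalarTower.algebraMap_apply k k[X] (RatFunc k)]
  -- Localizations and separable extensions are formally étale, so `Ω[K⁄k]` is the base change of
  -- `Ω[k[X]⁄k]`, which is free on `dX`.
  have h1 : Algebra.FormallyEtale k[X] (RatFunc k) :=
    Algebra.FormallyEtale.of_isLocalization (nonZeroDivisors k[X])
  have h2 : Algebra.FormallyEtale (RatFunc k) K := Algebra.FormallyEtale.of_isSeparable _ _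
  have h3 : Algebra.FormallyEtale k[X] K := Algebra.FormallyEtale.comp k[X] (RatFunc k) K
  let e : Ω[K⁄k] ≃ₗ[K] K :=
    (tensorKaehlerEquivOfFormallyEtale k k[X] K).symm.trans
      ((TensorProduct.AlgebraTensorModule.congr (LinearEquiv.refl K K)
        (polynomialEquiv k)).trans (AlgebraTensorModule.rid k[X] K K))
  have hX : e (D k K (algebraMap (RatFunc k) K RatFunc.X)) = 1 := by
    have : algebraMap (RatFunc k) K RatFunc.X = algebraMap k[X] K Polynomial.X := by
      rw [IsScalarTower.algebraMap_apply k[X] (RatFunc k) K, RatFunc.algebraMap_X]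
    rw [this]
    simp [e, tensorKaehlerEquivOfFormallyEtale_symm_D_algebraMap]
  refine ⟨e.toLinearMap.compDer (D k K), hX, fun y => e.injective ?_⟩
  rw [map_smul, hX, smul_eq_mul, mul_one]
  rfl

end Differentials

/-! ### Derivations and discrete valuations. -/

section DerivationValuation

open WithZero Polynomial

variable {k K : Type*} [Field k] [Field K] [Algebra k K] (w : Valuation K ℤᵐ⁰)

theorem WithZero.le_exp_neg_one_of_lt_one {x : ℤᵐ⁰} (hx : x < 1) : x ≤ exp (-1) := by
  by_cases h0 : x = 0
  · rw [h0]; exact zero_le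
  · rw [← log_le_iff_le_exp h0]
    have : log x < 0 := by rwa [log_lt_iff_lt_exp h0, exp_zero]
    omega

theorem Valuation.ne_zero_of_map_eq_exp {K : Type*} [Field K] (w : Valuation K ℤᵐ⁰) {t : K} {n : ℤ}
    (ht : w t = exp n) : t ≠ 0 := by
  rintro rfl
  rw [map_zero] at ht
  exact exp_ne_zero ht.symm

/-- `t`-adic expansions in a discrete valuation ring with coefficient field `k`. -/
theorem Valuation.exists_aeval_add_pow_mul
    (hres : ∀ y, w y ≤ 1 → ∃ c : k, w (y - algebraMap k K c) < 1) {t : K} (ht : w t = exp (-1))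
    (n : ℕ) {y : K} (hy : w y ≤ 1) :
    ∃ (P : k[X]) (y' : K), w y' ≤ 1 ∧ y = aeval t P + t ^ n * y' := by
  have ht0 : t ≠ 0 := w.ne_zero_of_map_eq_exp ht
  induction n generalizing y with
  | zero => exact ⟨0, y, hy, by simp⟩
  | succ n ih =>
    obtain ⟨P, y', hy', h⟩ := ih hy
    obtain ⟨c, hc⟩ := hres y' hy'
    refine ⟨P + C c * X ^ n, (y' - algebraMap k K c) / t, ?_, ?_⟩
    · have h1 : w (y' - algebraMap k K c) ≤ exp (-1) := by
        exact WithZero.le_exp_neg_one_of_lt_one hc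
      rw [map_div₀, ht]
      exact div_le_one_of_le₀ h1 zero_le
    · rw [h]
      simp only [map_add, map_mul, aeval_C, map_pow, aeval_X]
      field_simp
      ring

/-- Write `y = P(t) + t ^ n y'`. The polynomial contributes `P'(t) δ t`, and the remainder
contributes a multiple of `δ t` by an integral element plus `t ^ n δ y'`. The last term has
valuation at most `exp (N - n)`, which is negligible for large `n`; no completion is needed. -/
theorem Valuation.derivation_le (hk : ∀ c : k, w (algebraMap k K c) ≤ 1)
    (hres : ∀ y, w y ≤ 1 → ∃ c : k, w (y - algebraMap k K c) < 1) {t : K} (ht : w t = exp (-1))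
    (δ : Derivation k K K) (hδ : ∃ N : ℤ, ∀ y, w y ≤ 1 → w (δ y) ≤ exp N) {y : K} (hy : w y ≤ 1) :
    w (δ y) ≤ w (δ t) := by
  obtain ⟨N, hN⟩ := hδ
  have hnat : ∀ n : ℕ, w (n : K) ≤ 1 := fun n => by simpa using hk n
  have ht1 : w t ≤ 1 := by rw [ht, ← exp_zero]; exact exp_le_exp.2 (by norm_num)
  have hP : ∀ P : k[X], w (aeval t P) ≤ 1 := by
    intro P
    induction P using Polynomial.induction_on' with
    | add p q hp hq => rw [map_add]; exact (w.map_add _ _).trans (max_le hp hq)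
    | monomial n c =>
      rw [aeval_monomial, map_mul, map_pow]
      exact mul_le_one' (hk c) (pow_le_one' ht1 n)
  have key : ∀ n : ℕ, w (δ y) ≤ max (w (δ t)) (exp (-(n : ℤ)) * exp N) := by
    intro n
    obtain ⟨P, y', hy', h⟩ := w.exists_aeval_add_pow_mul hres ht n hy
    have hd : δ y = aeval t (derivative P) * δ t + (t ^ n * δ y' + y' * (n * t ^ (n - 1)) * δ t) := by
      rw [h, map_add, Derivation.map_aeval, Derivation.leibniz, Derivation.leibniz_pow]
      simp only [smul_eq_mul, nsmul_eq_mul]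
      ring
    rw [hd]
    refine (w.map_add _ _).trans (max_le ?_ ((w.map_add _ _).trans (max_le ?_ ?_)))
    · rw [map_mul]
      exact (mul_le_of_le_one_left' (hP _)).trans (le_max_left _ _)
    · refine le_trans ?_ (le_max_right _ _)
      rw [map_mul, map_pow, ht, ← exp_nsmul]
      refine mul_le_mul' (le_of_eq ?_) (hN y' hy')
      simp
    · rw [map_mul]
      refine (mul_le_of_le_one_left' ?_).trans (le_max_left _ _)
      rw [map_mul, map_mul, map_pow]
      exact mul_le_one' hy' (mul_le_one' (hnat n) (pow_le_one' ht1 _))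
  by_contra! hlt
  have hy0 : w (δ y) ≠ 0 := (zero_le.trans_lt hlt).ne'
  obtain ⟨n, hn⟩ := exists_exp_neg_natCast_lt (mul_ne_zero hy0 (exp_ne_zero (a := -N)))
  have h2 : exp (-(n : ℤ)) * exp N < w (δ y) := by
    have := mul_lt_mul_of_pos_right hn (exp_pos (a := N))
    have h3 : exp (-N) * exp N = 1 := by rw [← exp_add, neg_add_cancel, exp_zero]
    rwa [mul_assoc, h3, mul_one] at this
  exact absurd (key n) (not_le.2 (max_lt hlt h2))

/-- If `δ t = 0`, the bound `Valuation.derivation_le` makes `δ` vanish on the valuation ring, hence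
on its fraction field `K`. -/
theorem Valuation.derivation_ne_zero (hk : ∀ c : k, w (algebraMap k K c) ≤ 1)
    (hres : ∀ y, w y ≤ 1 → ∃ c : k, w (y - algebraMap k K c) < 1) {t : K} (ht : w t = exp (-1))
    (δ : Derivation k K K) (hδ : ∃ N : ℤ, ∀ y, w y ≤ 1 → w (δ y) ≤ exp N) (hδ0 : δ ≠ 0) :
    δ t ≠ 0 := by
  intro h0
  refine hδ0 ?_
  have h1 : ∀ y, w y ≤ 1 → δ y = 0 := by
    intro y hy
    have := w.derivation_le hk hres ht δ hδ hy
    rwa [h0, map_zero, le_zero_iff, map_eq_zero] at this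
  ext y
  rcases le_total (w y) 1 with h | h
  · exact h1 y h
  · have h2 := h1 y⁻¹ (by rw [map_inv₀]; exact inv_le_one_of_one_le₀ h)
    have hy0 : y ≠ 0 := by rintro rfl; simp at h
    rw [Derivation.leibniz_inv] at h2
    simpa [hy0] using h2

/-- The valuation of the derivative of an element `s` of tame valuation `m`. -/
theorem Valuation.derivation_of_tame (hk : ∀ c : k, w (algebraMap k K c) ≤ 1)
    (hres : ∀ y, w y ≤ 1 → ∃ c : k, w (y - algebraMap k K c) < 1) {t : K} (ht : w t = exp (-1))
    (δ : Derivation k K K) (hδ : ∃ N : ℤ, ∀ y, w y ≤ 1 → w (δ y) ≤ exp N) (hδ0 : δ ≠ 0)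
    {s : K} {m : ℕ} (hm : (m : k) ≠ 0) (hs : w s = exp (-(m : ℤ))) :
    w (δ s) = exp (1 - (m : ℤ)) * w (δ t) := by
  have ht0 : t ≠ 0 := w.ne_zero_of_map_eq_exp ht
  have hδt := w.derivation_ne_zero hk hres ht δ hδ hδ0
  have hm0 : m ≠ 0 := by rintro rfl; simp at hm
  obtain ⟨l, rfl⟩ := Nat.exists_eq_succ_of_ne_zero hm0
  have hmK : w ((l + 1 : ℕ) : K) = 1 := by
    have h1 := hk ((l + 1 : ℕ) : k)
    have h2 := hk ((l + 1 : ℕ) : k)⁻¹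
    rw [map_inv₀, map_inv₀] at h2
    rw [map_natCast] at h1 h2
    refine le_antisymm h1 ?_
    have h3 : (0 : ℤᵐ⁰) < w ((l + 1 : ℕ) : K) := by
      rw [zero_lt_iff, Valuation.ne_zero_iff, ← map_natCast (algebraMap k K)]
      exact (_root_.map_ne_zero _).2 hm
    exact (inv_le_one₀ h3).1 h2
  have hε : w (s / t ^ (l + 1)) = 1 := by
    rw [map_div₀, map_pow, ht, hs, ← exp_nsmul]
    have : (l + 1) • (-1 : ℤ) = -((l + 1 : ℕ) : ℤ) := by simp
    rw [this]
    exact div_self exp_ne_zero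
  have hpow : ∀ n : ℕ, w (t ^ n) = exp (-(n : ℤ)) := by
    intro n
    rw [map_pow, ht, ← exp_nsmul]
    simp
  -- Here `s = ε t ^ m` with `ε` a unit and `m = l + 1`. As `m` is a unit too, the term `m ε t ^ (m
  -- - 1) δ t` strictly dominates `t ^ m δ ε`.
  have hd : δ s = s / t ^ (l + 1) * ((l + 1 : ℕ) * t ^ l) * δ t + t ^ (l + 1) * δ (s / t ^ (l + 1)) := by
    have h : s = s / t ^ (l + 1) * t ^ (l + 1) := by field_simp
    conv_lhs => rw [h]
    rw [Derivation.leibniz, Derivation.leibniz_pow]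
    simp only [smul_eq_mul, nsmul_eq_mul, Nat.add_sub_cancel]
    ring
  have h1 : w (s / t ^ (l + 1) * ((l + 1 : ℕ) * t ^ l) * δ t) = exp (-(l : ℤ)) * w (δ t) := by
    rw [map_mul, map_mul, map_mul, hε, hmK, one_mul, one_mul, hpow]
  have h2 : w (t ^ (l + 1) * δ (s / t ^ (l + 1))) < exp (-(l : ℤ)) * w (δ t) := by
    rw [map_mul, hpow]
    refine (mul_le_mul_right (w.derivation_le hk hres ht δ hδ hε.le) _).trans_lt ?_
    refine mul_lt_mul_of_pos_right (exp_lt_exp.2 ?_) ?_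
    · push_cast; omega
    · rw [zero_lt_iff]; simpa using hδt
  rw [hd, w.map_add_eq_of_lt_left (by rwa [h1]), h1]
  congr 2
  push_cast
  ring

end DerivationValuation

/-! ### Orders of differentials in terms of a valuation. -/

section Orders

open WithZero KaehlerDifferential DefData

variable {k K : Type*} [Field k] [Field K] [Algebra k K] (w : Valuation K ℤᵐ⁰)

/-- Translates the uniformizer clause of `HasOrderAt` into a valuation; `t₀` witnesses that the
value `exp (-1)` is attained. -/
theorem Valuation.generator_nonunits_iff {t₀ : K} (ht₀ : w t₀ = exp (-1)) (t : K) :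
    (∀ y : K, y ∈ w.valuationSubring.nonunits ↔ ∃ c ∈ w.valuationSubring, y = c * t) ↔
      w t = exp (-1) := by
  have hmem : ∀ y : K, y ∈ w.valuationSubring.nonunits ↔ w y < 1 := fun y => by
    rw [ValuationSubring.mem_nonunits_iff]
    exact w.isEquiv_valuation_valuationSubring.symm.lt_one_iff_lt_one
  simp only [hmem, Valuation.mem_valuationSubring_iff]
  have hlt : exp (-1 : ℤ) < 1 := by rw [← exp_zero]; exact exp_lt_exp.2 (by norm_num)
  constructor
  · intro h
    refine le_antisymm (le_exp_neg_one_of_lt_one ((h t).2 ⟨1, by simp, by simp⟩)) ?_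
    obtain ⟨c, hc, hc'⟩ := (h t₀).1 (ht₀ ▸ hlt)
    rw [← ht₀, hc', map_mul]
    exact mul_le_of_le_one_left' hc
  · intro h y
    constructor
    · intro hy
      have ht0 : t ≠ 0 := w.ne_zero_of_map_eq_exp h
      refine ⟨y / t, ?_, by field_simp⟩
      rw [map_div₀, h]
      exact div_le_one_of_le₀ (le_exp_neg_one_of_lt_one hy) zero_le
    · rintro ⟨c, hc, rfl⟩
      rw [map_mul, h]
      exact (mul_le_of_le_one_left' hc).trans_lt hlt

/-- The order of a differential, in terms of a derivation `δ` generating the derivations of `K`. -/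
theorem Valuation.ordAt_smul (hk : ∀ c : k, w (algebraMap k K c) ≤ 1)
    (hres : ∀ y, w y ≤ 1 → ∃ c : k, w (y - algebraMap k K c) < 1) {t : K} (ht : w t = exp (-1))
    (δ : Derivation k K K) (hδ : ∃ N : ℤ, ∀ y, w y ≤ 1 → w (δ y) ≤ exp N) (hδ0 : δ ≠ 0)
    {η : Ω[K⁄k]} (hη : η ≠ 0) (hD : ∀ y, D k K y = δ y • η) {g : K} (hg : g ≠ 0) :
    w g = exp (-ordAt w.valuationSubring (g • η)) * w (δ t) := by
  have hδt := w.derivation_ne_zero hk hres ht δ hδ hδ0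
  have ht0 : t ≠ 0 := w.ne_zero_of_map_eq_exp ht
  have hle : ∀ {t' : K}, w t' = exp (-1) → w t' ≤ 1 := fun h => by
    rw [h, ← exp_zero]; exact exp_le_exp.2 (by norm_num)
  have hval : ∀ n, HasOrderAt w.valuationSubring (g • η) n → w g = exp (-n) * w (δ t) := by
    rintro n ⟨t', v, -, hgen, hv, hv', hv0, h⟩
    rw [w.generator_nonunits_iff ht] at hgen
    have h1 : w (δ t') = w (δ t) :=
      le_antisymm (w.derivation_le hk hres ht δ hδ (hle hgen))
        (w.derivation_le hk hres hgen δ hδ (hle ht))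
    rw [hD, smul_smul] at h
    have h2 := smul_left_injective K hη h
    have h3 : w v = 1 := by
      refine le_antisymm hv ?_
      rw [Valuation.mem_valuationSubring_iff, map_inv₀] at hv'
      exact (inv_le_one₀ (by rw [zero_lt_iff]; simpa using hv0)).1 hv'
    rw [h2, map_mul, map_mul, h3, one_mul, map_zpow₀, hgen, h1, ← exp_zsmul]
    simp
  have hex : ∃ n, HasOrderAt w.valuationSubring (g • η) n := by
    -- This is the only possible order: `g dx = (g / δ t) dt`, when `dx` denotes `η`.
    set n := -(log (w (g / δ t))) with hn
    have hne : w (g / δ t) ≠ 0 := by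
      rw [Valuation.ne_zero_iff]; exact div_ne_zero hg hδt
    have hv1 : w (g / δ t * (t ^ n)⁻¹) = 1 := by
      rw [map_mul, map_inv₀, map_zpow₀, ht, ← exp_zsmul, hn, ← exp_log hne]
      simp
    refine ⟨n, t, g / δ t * (t ^ n)⁻¹, ht0, (w.generator_nonunits_iff ht t).2 ht, hv1.le, ?_, ?_, ?_⟩
    · rw [Valuation.mem_valuationSubring_iff, map_inv₀, hv1, inv_one]
    · rw [← w.ne_zero_iff, hv1]; exact one_ne_zero
    · rw [hD, smul_smul]
      congr 1
      have := zpow_ne_zero n ht0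
      field_simp
  rw [ordAt, dif_pos hex]
  exact hval _ hex.choose_spec

end Orders


/-! ### Jacobson's identity for polynomials. -/

section LogarithmicDerivatives

open Polynomial

variable {k R : Type*} [CommRing k] [CommRing R] [Algebra k R] (p : ℕ) [CharP R p]

theorem Derivation.map_pow_char_mul (δ : Derivation k R R) (a b : R) :
    δ (a ^ p * b) = a ^ p * δ b := by
  rw [Derivation.leibniz, Derivation.leibniz_pow]
  simp [nsmul_eq_mul]

theorem Derivation.iterate_pow_char_mul (δ : Derivation k R R) (n : ℕ) (a b : R) :
    δ^[n] (a ^ p * b) = a ^ p * δ^[n] b := by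
  induction n with
  | zero => rfl
  | succ n ih => rw [Function.iterate_succ_apply', Function.iterate_succ_apply', ih,
      δ.map_pow_char_mul p]

theorem Derivation.iterate_add {A B : Type*} [CommRing A] [CommRing B] [Algebra A B]
    (δ : Derivation A B B) (n : ℕ) (a b : B) : δ^[n] (a + b) = δ^[n] a + δ^[n] b := by
  induction n with
  | zero => rfl
  | succ n ih => simp only [Function.iterate_succ_apply', ih, map_add]

variable [Fact p.Prime]

/-- The elements that satisfy Jacobson's identity for logarithmic derivatives are closed under
multiplication. -/
theorem Derivation.jacobson_mul (δ : Derivation k R R) {a b : R}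
    (ha : δ^[p - 1] (a ^ (p - 1) * δ a) = -(δ a) ^ p)
    (hb : δ^[p - 1] (b ^ (p - 1) * δ b) = -(δ b) ^ p) :
    δ^[p - 1] ((a * b) ^ (p - 1) * δ (a * b)) = -(δ (a * b)) ^ p := by
  obtain ⟨q, hq⟩ : ∃ q, p = q + 1 := ⟨p - 1, by have := (Fact.out : p.Prime).pos; omega⟩
  have h : (a * b) ^ (p - 1) * δ (a * b) =
      a ^ p * (b ^ (p - 1) * δ b) + b ^ p * (a ^ (p - 1) * δ a) := by
    rw [Derivation.leibniz, smul_eq_mul, smul_eq_mul]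
    simp only [hq, Nat.add_sub_cancel]
    ring
  rw [h, δ.iterate_add, δ.iterate_pow_char_mul p, δ.iterate_pow_char_mul p, ha, hb,
    Derivation.leibniz, smul_eq_mul, smul_eq_mul, add_pow_char]
  ring

/-- The derivative is the constant `(p - 1)!`, so this is Wilson's theorem. It is Jacobson's
identity for a linear factor. -/
theorem Polynomial.iterate_derivative_X_sub_C_pow_pred {F : Type*} [Field F] [CharP F p] (c : F) :
    derivative^[p - 1] ((X - C c) ^ (p - 1)) = -1 := by
  have h : (((p - 1).factorial : ℕ) : F) = -1 := by
    have := congrArg (ZMod.castHom (dvd_refl p) F) (ZMod.wilsons_lemma p)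
    rwa [map_natCast, map_neg, map_one] at this
  rw [iterate_derivative_X_sub_pow_self, ← map_natCast (C : F →+* F[X]), h, map_neg, map_one]

/-- Jacobson's identity for polynomials over a field. -/
theorem Polynomial.jacobson {F : Type*} [Field F] [CharP F p] (f : F[X]) :
    derivative^[p - 1] (f ^ (p - 1) * derivative f) = -(derivative f) ^ p := by
  -- The identity is multiplicative, so over an algebraic closure it reduces to constants and linear
  -- factors.
  let E := AlgebraicClosure F
  have hmul : ∀ a b : E[X], derivative^[p - 1] (a ^ (p - 1) * derivative a) = -(derivative a) ^ p →
      derivative^[p - 1] (b ^ (p - 1) * derivative b) = -(derivative b) ^ p →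
      derivative^[p - 1] ((a * b) ^ (p - 1) * derivative (a * b)) = -(derivative (a * b)) ^ p :=
    fun a b ha hb => (derivative' (R := E)).jacobson_mul p ha hb
  have hC : ∀ c : E, derivative^[p - 1] ((C c) ^ (p - 1) * derivative (C c)) =
      -(derivative (C c)) ^ p := by
    intro c
    have := (Fact.out : p.Prime).ne_zero
    simp [this]
  have h : derivative^[p - 1] ((f.map (algebraMap F E)) ^ (p - 1) *
      derivative (f.map (algebraMap F E))) = -(derivative (f.map (algebraMap F E))) ^ p := by
    rw [(IsAlgClosed.splits (f.map (algebraMap F E))).eq_prod_roots]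
    refine hmul _ _ (hC _) ?_
    generalize (f.map (algebraMap F E)).roots = s
    induction s using Multiset.induction_on with
    | empty => simpa using hC 1
    | cons a s ih =>
      rw [Multiset.map_cons, Multiset.prod_cons]
      refine hmul _ _ ?_ ih
      rw [derivative_X_sub_C, mul_one, one_pow]
      exact iterate_derivative_X_sub_C_pow_pred p a
  apply map_injective _ (algebraMap F E).injective
  rw [← iterate_derivative_map]
  simpa [Polynomial.derivative_map] using h

end LogarithmicDerivatives

/-! ### Jacobson's formula for a derivation with `δ^p = 0`. -/

section NilpotentDerivation

open Polynomial TensorProduct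

variable {K : Type*} [Field K] (p : ℕ) [CharP K p]

/-- Elements killed by a power of a derivation `δ` with `δ x = 1` are polynomials in `x` with
constant coefficients. -/
theorem Derivation.exists_eq_sum_of_iterate_eq_zero {k : Type*} [CommRing k] [Algebra k K]
    (δ : Derivation k K K) {x : K} (hx : δ x = 1) (n : ℕ) (hn : n ≤ p) (f : K)
    (hf : δ^[n] f = 0) :
    ∃ c : ℕ → K, (∀ i, δ (c i) = 0) ∧ f = ∑ i ∈ Finset.range n, c i * x ^ i := by
  induction n generalizing f with
  | zero => exact ⟨0, by simp, by simpa using hf⟩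
  | succ n ih =>
    obtain ⟨c, hc, h⟩ := ih (by omega) (δ f) hf
    have hcast : ∀ i < n, ((i + 1 : ℕ) : K) ≠ 0 := fun i hi h0 =>
      absurd (Nat.le_of_dvd (by omega) ((CharP.cast_eq_zero_iff K p (i + 1)).1 h0)) (by omega)
    have hdn : ∀ i : ℕ, δ (((i + 1 : ℕ) : K)⁻¹) = 0 := fun i => by
      rw [Derivation.leibniz_inv, Derivation.map_natCast, smul_zero]
    -- Integrate the expansion of `δ f` term by term: the denominators satisfy `i + 1 ≤ n < p`,
    -- hence are invertible. The difference between `f` and this integral is a constant, the new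
    -- zeroth coefficient.
    let e : ℕ → K := fun i => c i * ((i + 1 : ℕ) : K)⁻¹
    have he : ∀ i, δ (e i) = 0 := fun i => by
      rw [Derivation.leibniz, hc, hdn, smul_zero, smul_zero, add_zero]
    refine ⟨fun i => Nat.casesOn i (f - ∑ i ∈ Finset.range n, e i * x ^ (i + 1)) e, ?_, ?_⟩
    · rintro (_ | i)
      · change δ (f - _) = 0
        rw [map_sub, h, map_sum, sub_eq_zero]
        refine Finset.sum_congr rfl fun i hi => ?_
        rw [Derivation.leibniz, he, Derivation.leibniz_pow, hx, smul_zero, add_zero,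
          Nat.add_sub_cancel]
        have := hcast i (Finset.mem_range.1 hi)
        simp only [e, smul_eq_mul, nsmul_eq_mul, mul_one]
        field_simp
      · exact he i
    · rw [Finset.sum_range_succ']
      simp

variable [Fact p.Prime]

/-- On `K ⊗ K` the operators `1 ⊗ δ` and `δ ⊗ 1` commute, so the `p`-th power of their sum is the
sum of their `p`-th powers. Multiplication intertwines the sum with `δ`. Hence `δ^p` is again a
derivation. -/
theorem Derivation.iterate_char_mul {k : Type*} [CommRing k] [Algebra k K] (δ : Derivation k K K)
    (a b : K) : δ^[p] (a * b) = a * δ^[p] b + b * δ^[p] a := by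
  let u : Module.End k (K ⊗[k] K) := LinearMap.lTensor K (δ : K →ₗ[k] K)
  let v : Module.End k (K ⊗[k] K) := LinearMap.rTensor K (δ : K →ₗ[k] K)
  have huv : Commute u v := by
    ext
    simp [u, v]
  have h := huv.add_pow_prime_eq' (Fact.out : p.Prime)
  let μ : K ⊗[k] K →ₗ[k] K := LinearMap.mul' k K
  have hμ : ∀ n (y : K ⊗[k] K), μ (((u + v) ^ n) y) = δ^[n] (μ y) := by
    intro n
    induction n with
    | zero => simp
    | succ n ih =>
      intro y
      rw [pow_succ, Module.End.mul_apply, ih, Function.iterate_succ_apply]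
      congr 1
      induction y using TensorProduct.induction_on with
      | zero => simp
      | tmul a b => simp [μ, u, v, mul_comm]
      | add a b ha hb => rw [map_add, map_add, ha, hb, map_add, map_add]
  have hu : ∀ n, (u ^ n) (a ⊗ₜ b) = a ⊗ₜ (δ^[n] b) := by
    intro n
    induction n with
    | zero => simp
    | succ n ih => rw [pow_succ', Module.End.mul_apply, ih, Function.iterate_succ_apply']; simp [u]
  have hv : ∀ n, (v ^ n) (a ⊗ₜ b) = (δ^[n] a) ⊗ₜ b := by
    intro n
    induction n with
    | zero => simp
    | succ n ih => rw [pow_succ', Module.End.mul_apply, ih, Function.iterate_succ_apply']; simp [v]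
  have h2 := hμ p (a ⊗ₜ b)
  rw [h] at h2
  rw [LinearMap.add_apply, LinearMap.add_apply, hu, hv, ← nsmul_eq_mul, LinearMap.smul_apply, map_add,
    map_add, map_nsmul, nsmul_eq_mul, CharP.cast_eq_zero, zero_mul, add_zero] at h2
  simpa [μ, mul_comm] using h2.symm

/-- Jacobson's formula for the iterated derivative of a logarithmic derivative. -/
theorem Derivation.iterate_logDeriv {k : Type*} [CommRing k] [Algebra k K]
    (δ : Derivation k K K) {x : K} (hx : δ x = 1) (hδ : ∀ f, δ^[p] f = 0) {f g : K} (hf : f ≠ 0)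
    (hg : δ f = g * f) : δ^[p - 1] g = - g ^ p := by
  obtain ⟨c, hc, h⟩ := δ.exists_eq_sum_of_iterate_eq_zero p hx p le_rfl f (hδ f)
  -- Over the field `C₀` of constants, `f` is the value at `x` of a polynomial `Φ`, and evaluation
  -- at `x` turns `d/dX` into `δ`. The formula thus follows from the polynomial identity.
  let C₀ : Subfield K :=
    { carrier := {c | δ c = 0}
      mul_mem' := fun {a b} ha hb => by
        change δ (a * b) = 0
        rw [Derivation.leibniz, show δ a = 0 from ha, show δ b = 0 from hb]; simp
      one_mem' := δ.map_one_eq_zero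
      add_mem' := fun {a b} ha hb => by
        change δ (a + b) = 0
        rw [map_add, show δ a = 0 from ha, show δ b = 0 from hb, add_zero]
      zero_mem' := map_zero δ
      neg_mem' := fun {a} ha => by
        change δ (-a) = 0
        rw [map_neg, show δ a = 0 from ha, neg_zero]
      inv_mem' := fun a ha => by
        change δ a⁻¹ = 0
        rw [Derivation.leibniz_inv, show δ a = 0 from ha, smul_zero] }
  have : CharP C₀ p := (algebraMap C₀ K).charP (algebraMap C₀ K).injective p
  let Φ : C₀[X] := ∑ i ∈ Finset.range p, C (⟨c i, hc i⟩ : C₀) * X ^ i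
  have hΦ : aeval x Φ = f := by
    rw [h]
    simp only [Φ, map_sum, map_mul, map_pow, aeval_X, aeval_C]
    rfl
  have hcomm : ∀ P : C₀[X], aeval x (derivative P) = δ (aeval x P) := by
    intro P
    induction P using Polynomial.induction_on' with
    | add p q hp hq => simp only [map_add, hp, hq]
    | monomial n a =>
      have ha : δ (algebraMap C₀ K a) = 0 := a.2
      rw [derivative_monomial, aeval_monomial, aeval_monomial, Derivation.leibniz, ha,
        Derivation.leibniz_pow, hx, map_mul, _root_.map_natCast (algebraMap C₀ K)]
      simp only [smul_eq_mul, nsmul_eq_mul]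
      ring
  have hiter : ∀ n (P : C₀[X]), aeval x (derivative^[n] P) = δ^[n] (aeval x P) := by
    intro n
    induction n with
    | zero => exact fun _ => rfl
    | succ n ih => intro P; rw [Function.iterate_succ_apply, Function.iterate_succ_apply, ih, hcomm]
  have h1 := congrArg (aeval x) (jacobson p Φ)
  rw [hiter, map_mul, map_pow, hcomm, map_neg, map_pow, hcomm, hΦ, hg] at h1
  have h2 : f ^ (p - 1) * (g * f) = f ^ p * g := by
    obtain ⟨q, hq⟩ : ∃ q, p = q + 1 := ⟨p - 1, by have := (Fact.out : p.Prime).pos; omega⟩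
    simp only [hq, Nat.add_sub_cancel]
    ring
  rw [h2, δ.iterate_pow_char_mul p] at h1
  refine mul_left_cancel₀ (pow_ne_zero p hf) ?_
  rw [h1]
  ring

end NilpotentDerivation


/-! ### Rational functions: derivation, factorization, local parameters. -/

section RationalFunctions

open Polynomial DefData

theorem Derivation.ratFunc_algebraMap {k K : Type*} [Field k] [Field K] [Algebra k K]
    [Algebra (RatFunc k) K] [IsScalarTower k (RatFunc k) K] (δ : Derivation k K K)
    (hδ : δ (algebraMap (RatFunc k) K RatFunc.X) = 1) (P : k[X]) :
    δ (algebraMap (RatFunc k) K (algebraMap k[X] (RatFunc k) P)) =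
      algebraMap (RatFunc k) K (algebraMap k[X] (RatFunc k) (derivative P)) := by
  have h : ∀ q : k[X], algebraMap (RatFunc k) K (algebraMap k[X] (RatFunc k) q) =
      aeval (algebraMap (RatFunc k) K RatFunc.X) q := fun q => by
    rw [aeval_algebraMap_apply, ← RatFunc.algebraMap_X, aeval_algebraMap_apply, aeval_X_left_apply]
  rw [h, h, Derivation.map_aeval, hδ, smul_eq_mul, mul_one]

theorem Derivation.apply_algebraMap_ratFunc {k K : Type*} [Field k] [Field K] [Algebra k K]
    [Algebra (RatFunc k) K] [IsScalarTower k (RatFunc k) K] (δ : Derivation k K K)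
    (hδ : δ (algebraMap (RatFunc k) K RatFunc.X) = 1) (f : RatFunc k) :
    δ (algebraMap (RatFunc k) K f) = algebraMap (RatFunc k) K (ratDeriv f) := by
  have hd : algebraMap k[X] (RatFunc k) f.denom ≠ 0 :=
    RatFunc.algebraMap_ne_zero f.denom_ne_zero
  conv_lhs => rw [← RatFunc.num_div_denom f]
  rw [map_div₀, Derivation.leibniz_div, δ.ratFunc_algebraMap hδ, δ.ratFunc_algebraMap hδ, ratDeriv]
  have hd' : algebraMap (RatFunc k) K (algebraMap k[X] (RatFunc k) f.denom) ≠ 0 :=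
    (_root_.map_ne_zero _).2 hd
  simp only [smul_eq_mul, map_div₀, map_sub, map_mul, map_pow]
  field_simp

theorem Derivation.eq_ratDeriv {k : Type*} [Field k] (δ : Derivation k (RatFunc k) (RatFunc k))
    (hδ : δ RatFunc.X = 1) (f : RatFunc k) : ratDeriv f = δ f :=
  (δ.apply_algebraMap_ratFunc hδ f).symm

theorem Derivation.iterate_algebraMap_ratFunc {k K : Type*} [Field k] [Field K] [Algebra k K]
    [Algebra (RatFunc k) K] [IsScalarTower k (RatFunc k) K] (δ : Derivation k K K)
    (hδ : δ (algebraMap (RatFunc k) K RatFunc.X) = 1) (n : ℕ) (f : RatFunc k) :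
    δ^[n] (algebraMap (RatFunc k) K f) = algebraMap (RatFunc k) K (ratDeriv^[n] f) := by
  induction n with
  | zero => rfl
  | succ n ih => rw [Function.iterate_succ_apply', Function.iterate_succ_apply', ih,
      δ.apply_algebraMap_ratFunc hδ]

theorem RatFunc.X_sub_C_ne_zero {k : Type*} [Field k] (b : k) :
    (RatFunc.X - RatFunc.C b : RatFunc k) ≠ 0 := by
  rw [← RatFunc.algebraMap_X, ← RatFunc.algebraMap_C, ← map_sub]
  exact RatFunc.algebraMap_ne_zero (Polynomial.X_sub_C_ne_zero b)

/-- Nonzero rational functions over an algebraically closed field are products of linear factors. -/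
theorem RatFunc.exists_eq_C_mul_prod {k : Type*} [Field k] [IsAlgClosed k] {f : RatFunc k}
    (hf : f ≠ 0) : ∃ (c : k) (n : k →₀ ℤ), c ≠ 0 ∧
      f = RatFunc.C c * n.prod fun b e => (RatFunc.X - RatFunc.C b) ^ e := by
  classical
  -- The products of the required form are a group, so it suffices to treat numerators and
  -- denominators, that is, constants and linear factors.
  let S : Subgroup (RatFunc k)ˣ :=
    { carrier := {f | ∃ (c : k) (n : k →₀ ℤ), c ≠ 0 ∧
        (f : RatFunc k) = RatFunc.C c * n.prod fun b e => (RatFunc.X - RatFunc.C b) ^ e}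
      one_mem' := ⟨1, 0, one_ne_zero, by simp⟩
      mul_mem' := by
        rintro _ _ ⟨c, n, hc, h⟩ ⟨c', n', hc', h'⟩
        refine ⟨c * c', n + n', mul_ne_zero hc hc', ?_⟩
        rw [Units.val_mul, h, h', Finsupp.prod_add_index' (fun b => zpow_zero _)
          (fun b => zpow_add₀ (RatFunc.X_sub_C_ne_zero b)), map_mul]
        ring
      inv_mem' := by
        rintro _ ⟨c, n, hc, h⟩
        refine ⟨c⁻¹, -n, inv_ne_zero hc, ?_⟩
        rw [Units.val_inv_eq_inv_val, h, Finsupp.prod_neg_index (fun b => zpow_zero _), mul_inv,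
          map_inv₀]
        simp [Finsupp.prod, Finset.prod_inv_distrib] }
  have hC : ∀ (u : (RatFunc k)ˣ) (c : k), (u : RatFunc k) = RatFunc.C c → u ∈ S := fun u c h =>
    ⟨c, 0, by rintro rfl; simp at h, by simpa using h⟩
  have hX : ∀ (u : (RatFunc k)ˣ) (b : k), (u : RatFunc k) = RatFunc.X - RatFunc.C b → u ∈ S :=
    fun u b h => ⟨1, Finsupp.single b 1, one_ne_zero, by simp [h]⟩
  have hpoly : ∀ P : k[X], ∀ u : (RatFunc k)ˣ, (u : RatFunc k) = algebraMap k[X] (RatFunc k) P →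
      u ∈ S := by
    intro P u hu
    have hP := (IsAlgClosed.splits P).eq_prod_roots
    generalize P.roots = s at hP
    generalize P.leadingCoeff = c at hP
    subst hP
    induction s using Multiset.induction_on generalizing u with
    | empty => exact hC u c (by simpa using hu)
    | cons a s ih =>
      let v : (RatFunc k)ˣ := Units.mk0 _ (RatFunc.X_sub_C_ne_zero a)
      have h2 := ih (u * v⁻¹) (by
        rw [Units.val_mul, hu, Units.val_inv_eq_inv_val, Multiset.map_cons, Multiset.prod_cons]
        have := RatFunc.X_sub_C_ne_zero a
        simp only [v, Units.val_mk0, map_mul, map_sub, RatFunc.algebraMap_X, RatFunc.algebraMap_C]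
        field_simp)
      have h3 := S.mul_mem h2 (hX v a rfl)
      rwa [inv_mul_cancel_right] at h3
  have hd : algebraMap k[X] (RatFunc k) f.denom ≠ 0 :=
    RatFunc.algebraMap_ne_zero f.denom_ne_zero
  have hn : algebraMap k[X] (RatFunc k) f.num ≠ 0 :=
    RatFunc.algebraMap_ne_zero (RatFunc.num_ne_zero hf)
  obtain ⟨c, n, hc, h⟩ := S.mul_mem (hpoly _ (Units.mk0 _ hn) rfl)
    (S.inv_mem (hpoly _ (Units.mk0 _ hd) rfl))
  refine ⟨c, n, hc, ?_⟩
  rw [← h]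
  simp [← div_eq_mul_inv]

/-- Translate at a finite point; at infinity rewrite a polynomial in `1 / x` by reversing its
coefficients. This supplies the generation hypothesis of
`ValuationSubring.exists_valuation_of_param`. -/
theorem RatFunc.exists_aeval_localParam {k : Type*} [Field k] (P : OnePoint k) (f : RatFunc k) :
    ∃ A B : k[X], f = aeval (localParam P) A / aeval (localParam P) B := by
  induction P using OnePoint.rec with
  | infty =>
    change ∃ A B : k[X], f = aeval (RatFunc.X : RatFunc k)⁻¹ A / aeval (RatFunc.X : RatFunc k)⁻¹ B
    have hX : (RatFunc.X : RatFunc k) ≠ 0 := RatFunc.X_ne_zero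
    have h : ∀ q : k[X], algebraMap k[X] (RatFunc k) q =
        aeval (RatFunc.X : RatFunc k)⁻¹ q.reverse * RatFunc.X ^ q.natDegree := by
      intro q
      let : Invertible (RatFunc.X : RatFunc k) := invertibleOfNonzero hX
      have := eval₂_reverse_mul_pow (algebraMap k (RatFunc k)) RatFunc.X q
      rw [invOf_eq_inv] at this
      rw [aeval_def, this, ← aeval_def, ← RatFunc.algebraMap_X, aeval_algebraMap_apply,
        aeval_X_left_apply]
    refine ⟨f.num.reverse * Polynomial.X ^ f.denom.natDegree, f.denom.reverse * Polynomial.X ^ f.num.natDegree, ?_⟩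
    conv_lhs => rw [← RatFunc.num_div_denom f, h, h]
    simp only [map_mul, map_pow, aeval_X, inv_pow]
    field_simp
  | coe a =>
    change ∃ A B : k[X], f = aeval (RatFunc.X - RatFunc.C a) A / aeval (RatFunc.X - RatFunc.C a) B
    have h : ∀ q : k[X], aeval (RatFunc.X - RatFunc.C a) (q.comp (Polynomial.X + Polynomial.C a)) =
        algebraMap k[X] (RatFunc k) q := by
      intro q
      rw [aeval_comp, map_add, aeval_X, aeval_C, RatFunc.algebraMap_eq_C, sub_add_cancel,
        ← RatFunc.algebraMap_X, aeval_algebraMap_apply, aeval_X_left_apply]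
    refine ⟨f.num.comp (Polynomial.X + Polynomial.C a), f.denom.comp (Polynomial.X + Polynomial.C a), ?_⟩
    rw [h, h, RatFunc.num_div_denom]

end RationalFunctions

theorem WithZero.prod_exp {ι : Type*} (S : Finset ι) (f : ι → ℤ) :
    ∏ i ∈ S, WithZero.exp (f i) = WithZero.exp (∑ i ∈ S, f i) := by
  classical
  induction S using Finset.induction_on with
  | empty => rfl
  | insert a S ha ih => rw [Finset.prod_insert ha, Finset.sum_insert ha, ih, WithZero.exp_add]

/-! ### Derivations when one differential generates. -/

section KaehlerGenerator

open DefData KaehlerDifferential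

variable {k K : Type*} [Field k] [Field K] [Algebra k K]

theorem Derivation.eq_smul_of_D_eq {δ : Derivation k K K} {x : K}
    (hD : ∀ y, D k K y = δ y • D k K x) (E : Derivation k K K) (y : K) : E y = δ y * E x := by
  have := congrArg E.liftKaehlerDifferential (hD y)
  rwa [_root_.map_smul, Derivation.liftKaehlerDifferential_comp_D,
    Derivation.liftKaehlerDifferential_comp_D, smul_eq_mul] at this

/-- Since `dx` generates `Ω[K⁄k]`, the derivation `δ^p` is determined by its value at `x`, and `δ^p
x = δ^(p-1) 1 = 0`. -/
theorem Derivation.iterate_char_eq_zero {p : ℕ} [Fact p.Prime] [CharP k p] {δ : Derivation k K K} {x : K} (hx : δ x = 1)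
    (hD : ∀ y, D k K y = δ y • D k K x) (y : K) : δ^[p] y = 0 := by
  have : CharP K p := charP_of_injective_algebraMap (algebraMap k K).injective p
  let E : Derivation k K K := Derivation.mk' ((δ : K →ₗ[k] K) ^ p) fun a b => by
    simp only [Module.End.pow_apply]
    exact δ.iterate_char_mul p a b
  have hE : ∀ y, E y = δ^[p] y := fun y => by
    change ((δ : K →ₗ[k] K) ^ p) y = _
    rw [Module.End.pow_apply]
    rfl
  have h0 : δ^[p] x = 0 := by
    obtain ⟨q, hq⟩ : ∃ q, p = q + 2 := ⟨p - 2, by have := (Fact.out : p.Prime).two_le; omega⟩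
    rw [hq, Function.iterate_succ_apply, hx, Function.iterate_succ_apply, δ.map_one_eq_zero]
    exact Function.iterate_fixed (map_zero δ) q
  rw [← hE, Derivation.eq_smul_of_D_eq hD E, hE, h0, mul_zero]

end KaehlerGenerator

/-! ### From a deformation datum to a rational function. -/

section Datum

open Polynomial DefData KaehlerDifferential WithZero

variable {p : ℕ} [Fact p.Prime] {k K : Type*} [Field k] [CharP k p] [Field K]
  [Algebra k K] [Algebra (RatFunc k) K] [IsScalarTower k (RatFunc k) K]

theorem DefData.DeformationDatum.m_dvd (Δ : DeformationDatum p k K) (P : OnePoint k) :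
    Δ.m P ∣ p - 1 := by
  refine (Subgroup.card_subgroup_dvd_card _).trans ?_
  have := Subgroup.card_dvd_of_injective Δ.χ Δ.χ_injective
  rwa [Nat.card_eq_fintype_card (α := (ZMod p)ˣ), ZMod.card_units] at this

variable [IsAlgClosed k] [FiniteDimensional (RatFunc k) K] [IsGalois (RatFunc k) K]

/-- The normalized valuation at the chosen point above `P`, and the order of a differential there. -/
theorem DefData.DeformationDatum.exists_valuation (Δ : DeformationDatum p k K) (P : OnePoint k)
    (δ : Derivation k K K) (hδ : δ (algebraMap (RatFunc k) K RatFunc.X) = 1)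
    (hD : ∀ y, D k K y = δ y • D k K (algebraMap (RatFunc k) K RatFunc.X)) {g : K} (hg : g ≠ 0)
    (hω : Δ.ω = g • D k K (algebraMap (RatFunc k) K RatFunc.X)) :
    ∃ w : Valuation K ℤᵐ⁰, (∀ c : k, c ≠ 0 → w (algebraMap k K c) = 1) ∧
      w (algebraMap (RatFunc k) K (localParam P)) = exp (-(Δ.m P : ℤ)) ∧
      w g = exp (Δ.m P - Δ.h P) * w (δ (algebraMap (RatFunc k) K (localParam P))) := by
  have hη : D k K (algebraMap (RatFunc k) K RatFunc.X) ≠ 0 := fun h0 => Δ.ω_ne_zero (by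
    rw [hω, h0, smul_zero])
  have hδ0 : δ ≠ 0 := by rintro rfl; simp at hδ
  obtain ⟨hk, hs⟩ := (exists_liesAbove (K := K) P).choose_spec
  obtain ⟨w, hwz, ⟨t, ht⟩, hres, hws, hbd⟩ := ValuationSubring.exists_valuation_of_param
    (F := RatFunc k) (localParam_transcendental P) (RatFunc.exists_aeval_localParam P) _ hk hs
  have hk' : ∀ c : k, w (algebraMap k K c) ≤ 1 := fun c => by
    rw [← Valuation.mem_valuationSubring_iff, hwz]
    exact hk c
  -- Tameness: `m_P` divides `p - 1`, hence is prime to `p`.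
  have hm : (Δ.m P : k) ≠ 0 := by
    intro h0
    have h1 := (CharP.cast_eq_zero_iff k p _).1 h0
    have h2 := Nat.le_of_dvd (by have := (Fact.out : p.Prime).two_le; omega)
      (h1.trans (Δ.m_dvd P))
    have := (Fact.out : p.Prime).two_le
    omega
  refine ⟨w, fun c hc => ?_, hws, ?_⟩
  · refine le_antisymm (hk' c) ?_
    have h2 := hk' c⁻¹
    rw [map_inv₀, map_inv₀] at h2
    exact (inv_le_one₀ (by rw [zero_lt_iff]; simpa using hc)).1 h2
  · rw [w.derivation_of_tame hk' hres ht δ (hbd δ) hδ0 hm hws, ← mul_assoc, ← exp_add,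
      w.ordAt_smul hk' hres ht δ (hbd δ) hδ0 hη hD hg]
    congr 2
    rw [DeformationDatum.h, hω, hwz, pointAbove]
    ring

/-- The rational function `G = (ω / dx) ^ (p - 1)` attached to a deformation datum: its divisor
determines the ramification invariants, and the condition that `ω` is logarithmic is a condition
on `1 / G`. -/
theorem DefData.DeformationDatum.exists_divisor (Δ : DeformationDatum p k K) :
    ∃ (c : k) (n : k →₀ ℤ), c ≠ 0 ∧
      (∀ b : k, ((p : ℚ) - 1) * (Δ.σ (b : OnePoint k) - 1) = n b) ∧
      (((p : ℚ) - 1) * (Δ.σ OnePoint.infty + 1) = -(n.sum fun _ e => e : ℤ)) ∧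
      ratDeriv^[p - 1] (RatFunc.C c * n.prod fun b e => (RatFunc.X - RatFunc.C b) ^ e)⁻¹ = -1 := by
  obtain ⟨δ, hδ, hD⟩ := RatFunc.exists_derivation k K
  have : CharP K p := charP_of_injective_algebraMap (algebraMap k K).injective p
  have hp2 := (Fact.out : p.Prime).two_le
  set x : K := algebraMap (RatFunc k) K RatFunc.X with hx
  obtain ⟨g, hω⟩ : ∃ g : K, Δ.ω = g • D k K x := by
    have h : Δ.ω ∈ Submodule.span K (Set.range (D k K)) := by
      rw [KaehlerDifferential.span_range_derivation]; trivial
    have h2 : Submodule.span K (Set.range (D k K)) ≤ Submodule.span K {D k K x} := by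
      rw [Submodule.span_le]
      rintro _ ⟨y, rfl⟩
      rw [hD y]
      exact Submodule.smul_mem _ _ (Submodule.mem_span_singleton_self _)
    obtain ⟨g, hg⟩ := Submodule.mem_span_singleton.1 (h2 h)
    exact ⟨g, hg.symm⟩
  have hη : D k K x ≠ 0 := fun h0 => Δ.ω_ne_zero (by rw [hω, h0, smul_zero])
  have hg : g ≠ 0 := fun h0 => Δ.ω_ne_zero (by rw [hω, h0, zero_smul])
  -- `β` fixes `x`, so it multiplies `g` by `χ β`, whose `(p - 1)`-th power is `1`.
  have hfix : ∀ β : K ≃ₐ[RatFunc k] K, β (g ^ (p - 1)) = g ^ (p - 1) := by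
    intro β
    have h := Δ.equivariant β
    rw [hω, pullback_smul_D] at h
    have h1 : (β.restrictScalars k) x = x := β.commutes _
    rw [h1, ← algebraMap_smul K (ZMod.castHom (dvd_refl p) k (Δ.χ β : ZMod p)), smul_smul] at h
    have h2 := smul_left_injective K hη h
    rw [map_pow]
    change ((β.restrictScalars k) g) ^ (p - 1) = _
    rw [h2, mul_pow, ← map_pow, ← map_pow, ← Units.val_pow_eq_pow_val, ZMod.units_pow_card_sub_one_eq_one,
      Units.val_one, map_one, map_one, one_mul]
  obtain ⟨G, hG⟩ := (IsGalois.mem_range_algebraMap_iff_fixed (F := RatFunc k) (g ^ (p - 1))).2 hfix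
  have hG0 : G ≠ 0 := by
    rintro rfl
    rw [map_zero] at hG
    exact pow_ne_zero _ hg hG.symm
  obtain ⟨c, n, hc, hn⟩ := RatFunc.exists_eq_C_mul_prod hG0
  have hwG : ∀ w : Valuation K ℤᵐ⁰, (∀ c : k, c ≠ 0 → w (algebraMap k K c) = 1) →
      w g ^ (p - 1) =
        n.prod fun b e => w (algebraMap (RatFunc k) K (RatFunc.X - RatFunc.C b)) ^ e := by
    intro w hw
    rw [← map_pow, ← hG, hn, map_mul, map_mul, ← RatFunc.algebraMap_eq_C,
      ← IsScalarTower.algebraMap_apply, hw c hc, one_mul, Finsupp.prod, map_prod, map_prod]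
    exact Finset.prod_congr rfl fun b _ => by rw [map_zpow₀, map_zpow₀]
  have hm0 : ∀ P, 0 < Δ.m P := fun P => Nat.pos_of_dvd_of_pos (Δ.m_dvd P) (by omega)
  refine ⟨c, n, hc, fun b => ?_, ?_, ?_⟩
  · obtain ⟨w, hw, hws, hwg⟩ := Δ.exists_valuation (b : OnePoint k) δ hδ hD hg hω
    have hlp : localParam (b : OnePoint k) = RatFunc.X - RatFunc.C b := rfl
    rw [hlp] at hws hwg
    have hδs : δ (algebraMap (RatFunc k) K (RatFunc.X - RatFunc.C b)) = 1 := by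
      rw [map_sub, map_sub, hδ, ← RatFunc.algebraMap_eq_C, ← IsScalarTower.algebraMap_apply,
        Derivation.map_algebraMap, sub_zero]
    -- Above `b` only the factor `X - b` has nontrivial valuation, so the valuation of `G` isolates
    -- `n b`.
    have hb' : ∀ b' : k, b' ≠ b → w (algebraMap (RatFunc k) K (RatFunc.X - RatFunc.C b')) = 1 := by
      intro b' hbb
      have h1 := hw (b - b') (sub_ne_zero.2 hbb.symm)
      have h2 : algebraMap (RatFunc k) K (RatFunc.X - RatFunc.C b') =
          algebraMap (RatFunc k) K (RatFunc.X - RatFunc.C b) + algebraMap k K (b - b') := by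
        rw [IsScalarTower.algebraMap_apply k (RatFunc k) K, RatFunc.algebraMap_eq_C, ← map_add,
          map_sub RatFunc.C]
        ring_nf
      rw [h2, w.map_add_eq_of_lt_right, h1]
      rw [h1, hws, ← exp_zero]
      exact exp_lt_exp.2 (by have := hm0 (b : OnePoint k); omega)
    have h3 := hwG w hw
    rw [hwg, hδs, map_one, mul_one, Finsupp.prod, Finset.prod_eq_single b
      (fun b' _ hbb => by rw [hb' b' hbb, one_zpow])
      (fun hb => by rw [Finsupp.notMem_support_iff.1 hb, zpow_zero]), hws, ← exp_nsmul,
      ← exp_zsmul, exp_inj, nsmul_eq_mul, smul_eq_mul, Nat.cast_sub (by omega)] at h3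
    have h4 : ((p : ℚ) - 1) * (Δ.m (b : OnePoint k) - Δ.h (b : OnePoint k)) =
        n b * -Δ.m (b : OnePoint k) := by exact_mod_cast h3
    have hm := hm0 (b : OnePoint k)
    have hm' : (Δ.m (b : OnePoint k) : ℚ) ≠ 0 := by exact_mod_cast hm.ne'
    rw [DeformationDatum.σ]
    field_simp
    linear_combination -h4
  · obtain ⟨w, hw, hws, hwg⟩ := Δ.exists_valuation OnePoint.infty δ hδ hD hg hω
    have hlp : (localParam OnePoint.infty : RatFunc k) = RatFunc.X⁻¹ := rfl
    rw [hlp, map_inv₀] at hws hwg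
    have hx0 : x ≠ 0 := by rw [hx]; exact (_root_.map_ne_zero _).2 RatFunc.X_ne_zero
    have hwx : w x = exp (Δ.m OnePoint.infty : ℤ) := by
      rw [map_inv₀, exp_neg] at hws
      exact inv_injective hws
    have hδs : w (δ x⁻¹) = exp (-(2 * Δ.m OnePoint.infty : ℤ)) := by
      rw [Derivation.leibniz_inv, hδ, smul_eq_mul, mul_one, Valuation.map_neg, map_pow, map_inv₀,
        hwx, ← exp_neg, ← exp_nsmul]
      congr 1
      simp
    -- Above infinity every linear factor has a pole of order `m`, so the sum of all exponents
    -- appears. The factor `-x⁻²` from differentiating `x⁻¹` changes `σ - 1` into `σ + 1`.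
    have hb' : ∀ b' : k, w (algebraMap (RatFunc k) K (RatFunc.X - RatFunc.C b')) =
        exp (Δ.m OnePoint.infty : ℤ) := by
      intro b'
      rw [map_sub, sub_eq_add_neg, w.map_add_eq_of_lt_left, ← hx, hwx]
      have h1 : w (-algebraMap (RatFunc k) K (RatFunc.C b')) ≤ 1 := by
        rw [Valuation.map_neg, ← RatFunc.algebraMap_eq_C, ← IsScalarTower.algebraMap_apply]
        rcases eq_or_ne b' 0 with rfl | hb0
        · simp
        · exact (hw b' hb0).le
      refine h1.trans_lt ?_
      rw [← hx, hwx, ← exp_zero]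
      exact exp_lt_exp.2 (by have := hm0 OnePoint.infty; omega)
    have h3 := hwG w hw
    rw [← hx, hδs, ← exp_add] at hwg
    simp only [hwg, hb', Finsupp.prod, ← exp_nsmul, ← exp_zsmul, WithZero.prod_exp] at h3
    rw [exp_inj, nsmul_eq_mul, Nat.cast_sub (by omega)] at h3
    simp only [smul_eq_mul, ← Finset.sum_mul] at h3
    have h4 : ((p : ℚ) - 1) * (Δ.m OnePoint.infty - Δ.h OnePoint.infty + -(2 * Δ.m OnePoint.infty)) =
        ((n.sum fun _ e => e : ℤ) : ℚ) * Δ.m OnePoint.infty := by exact_mod_cast h3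
    have hm := hm0 OnePoint.infty
    have hm' : (Δ.m OnePoint.infty : ℚ) ≠ 0 := by exact_mod_cast hm.ne'
    rw [DeformationDatum.σ]
    field_simp
    linear_combination -h4
  · rw [← hn]
    obtain ⟨f, hf, hlog⟩ := Δ.logarithmic
    have h1 : δ f = g * f := by
      rw [hω, hD f, smul_smul] at hlog
      rw [smul_left_injective K hη hlog]
      field_simp
    have h2 := δ.iterate_logDeriv p hδ (Derivation.iterate_char_eq_zero hδ hD) hf h1
    have h3 : g = g ^ p * algebraMap (RatFunc k) K G⁻¹ := by
      rw [map_inv₀, hG]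
      have h4 : g ^ p = g ^ (p - 1) * g := by rw [← pow_succ, Nat.sub_add_cancel (by omega)]
      rw [h4]
      field_simp
    rw [h3, δ.iterate_pow_char_mul p, δ.iterate_algebraMap_ratFunc hδ, ← h3] at h2
    apply (algebraMap (RatFunc k) K).injective
    refine mul_left_cancel₀ (pow_ne_zero p hg) ?_
    rw [h2, map_neg, map_one]
    ring

end Datum


/-! ### Polynomial solutions in characteristic `p`. -/

section FuchsianPolynomials

open Polynomial

variable {k : Type*} [Field k] (p : ℕ) [CharP k p]

theorem Polynomial.iterate_derivative_pow_char_mul (n : ℕ) (a b : k[X]) :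
    derivative^[n] (a ^ p * b) = a ^ p * derivative^[n] b :=
  (derivative' (R := k)).iterate_pow_char_mul p n a b

variable [Fact p.Prime]

theorem Polynomial.iterate_derivative_char_eq_zero (f : k[X]) : derivative^[p] f = 0 := by
  have h := congrFun (factorial_smul_hasseDeriv (R := k) p) f
  rw [← h, LinearMap.smul_apply, nsmul_eq_mul,
    (CharP.cast_eq_zero_iff k[X] p _).2 ((Fact.out : p.Prime).dvd_factorial.2 le_rfl), zero_mul]

/-- Expand `W` to first order at `b`. The constant term yields degree `p - 2`, which is killed; the
linear term yields `-W'(b)` by Wilson; the rest carries the differential constant `(X - b) ^ p`,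
which vanishes at `b`. -/
theorem Polynomial.eval_iterate_derivative_X_sub_C_pow_mul (hp : 2 < p) (b : k) (W : k[X]) :
    (derivative^[p - 1] ((X - C b) ^ (p - 2) * W)).eval b = -(derivative W).eval b := by
  have hdiv : ∀ V : k[X], ∃ V', V = C (V.eval b) + (X - C b) * V' := fun V => by
    obtain ⟨V', h⟩ := X_sub_C_dvd_sub_C_eval (a := b) (p := V)
    exact ⟨V', by rw [← h]; ring⟩
  obtain ⟨W₁, h₁⟩ := hdiv W
  obtain ⟨W₂, h₂⟩ := hdiv W₁
  have hW' : (derivative W).eval b = W₁.eval b := by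
    rw [h₁]; simp
  obtain ⟨q, rfl⟩ : ∃ q, p = q + 3 := ⟨p - 3, by omega⟩
  have e : (X - C b) ^ (q + 3 - 2) * W = W.eval b • (X - C b) ^ (q + 1) +
      W₁.eval b • (X - C b) ^ (q + 3 - 1) + (X - C b) ^ (q + 3) * W₂ := by
    conv_lhs => rw [h₁, h₂]
    simp only [smul_eq_C_mul, show q + 3 - 2 = q + 1 by omega, show q + 3 - 1 = q + 2 by omega]
    ring
  rw [e, iterate_map_add, iterate_map_add, iterate_derivative_smul, iterate_derivative_smul,
    iterate_derivative_pow_char_mul, iterate_derivative_X_sub_C_pow_pred (q + 3),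
    iterate_derivative_eq_zero, hW']
  · simp
  · rw [natDegree_pow, natDegree_X_sub_C]; omega

theorem Polynomial.exists_eq_pow_of_derivative_eq_zero [IsAlgClosed k] {f : k[X]}
    (hf : derivative f = 0) : ∃ g : k[X], f = g ^ p := by
  have h := expand_contract p hf (Fact.out : p.Prime).ne_zero
  have : ExpChar k p := ExpChar.prime Fact.out
  have hc : ((contract p f).map (frobeniusEquiv k p).symm.toRingHom).map (frobenius k p) =
      contract p f := by
    rw [Polynomial.map_map, show (frobenius k p).comp (frobeniusEquiv k p).symm.toRingHom =
      RingHom.id k from RingHom.ext fun x => frobenius_apply_frobeniusEquiv_symm k p x,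
      Polynomial.map_id]
  refine ⟨(contract p f).map (frobeniusEquiv k p).symm.toRingHom, ?_⟩
  rw [← map_frobenius_expand p, map_expand, hc, h]

/-- The solutions of `N w'' - M w' + P w = 0` are the multiples of the solution `u` by `p`-th
powers, if `M / N` is the logarithmic derivative of `Z` and a derivative of `u ^ (p - 2) Z` does
not vanish. -/
theorem Polynomial.exists_eq_pow_mul_of_wronskian [IsAlgClosed k] (hp : 2 < p)
    {N M P Z u w : k[X]} (hN : N ≠ 0) (hZ : Z ≠ 0) (hNZ : N * derivative Z = M * Z)
    (hu : u.Separable)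
    (hF : derivative^[p - 1] (u ^ (p - 2) * Z) ≠ 0)
    (hu' : N * derivative (derivative u) - M * derivative u + P * u = 0)
    (hw : N * derivative (derivative w) - M * derivative w + P * w = 0) :
    ∃ a, w = a ^ p * u := by
  have hp0 := (Fact.out : p.Prime)
  obtain ⟨q, rfl⟩ : ∃ q, p = q + 3 := ⟨p - 3, by omega⟩
  set V := u * derivative w - derivative u * w with hV
  have hVM : N * derivative V = M * V := by
    simp only [hV, derivative_sub, derivative_mul]
    linear_combination u * hw - w * hu'
  have hq : ((q : k[X]) + 3) = 0 := by
    have := CharP.cast_eq_zero k[X] (q + 3)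
    push_cast at this
    exact this
  -- The Wronskian `V` and `Z` have the same logarithmic derivative `M / N`, so `V Z ^ (p - 1)`,
  -- which is `(V / Z) Z ^ p`, is a constant.
  have hY : derivative (V * Z ^ (q + 2)) = 0 := by
    apply mul_left_cancel₀ hN
    rw [derivative_mul, derivative_pow]
    simp only [Nat.cast_add, Nat.cast_ofNat, map_add, map_natCast, show q + 2 - 1 = q + 1 by omega]
    have h2 : (C (2 : k)) = 2 := rfl
    rw [h2]
    linear_combination Z ^ (q + 2) * hVM + V * (q + 2) * Z ^ (q + 1) * hNZ +
      M * V * Z ^ (q + 2) * hq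
  obtain ⟨y, hy⟩ := exists_eq_pow_of_derivative_eq_zero (q + 3) hY
  have huw : derivative (u ^ (q + 2) * w) = u ^ (q + 1) * V := by
    rw [derivative_mul, derivative_pow]
    simp only [Nat.cast_add, Nat.cast_ofNat, map_add, map_natCast, show q + 2 - 1 = q + 1 by omega]
    have h2 : (C (2 : k)) = 2 := rfl
    rw [h2, hV]
    linear_combination u ^ (q + 1) * derivative u * w * hq
  -- Up to the factor `Z ^ p`, the polynomial `y ^ p u ^ (p - 2) Z` is `u ^ (p - 2) V`, the
  -- derivative of `u ^ (p - 1) w`. One more round of `p - 1` derivatives completes `D^p = 0`.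
  have hzero : y ^ (q + 3) * derivative^[q + 3 - 1] (u ^ (q + 3 - 2) * Z) = 0 := by
    rw [← iterate_derivative_pow_char_mul (q + 3), ← hy,
      show V * Z ^ (q + 2) * (u ^ (q + 3 - 2) * Z) = Z ^ (q + 3) * (u ^ (q + 1) * V) by
        rw [show q + 3 - 2 = q + 1 by omega]; ring, ← huw,
      iterate_derivative_pow_char_mul (q + 3), ← Function.iterate_succ_apply,
      show (q + 3 - 1).succ = q + 3 by omega, iterate_derivative_char_eq_zero (q + 3), mul_zero]
  have hV0 : V = 0 := by
    have h1 : y = 0 := pow_eq_zero_iff (by omega) |>.1 ((mul_eq_zero.1 hzero).resolve_right hF)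
    rw [h1, zero_pow (by omega)] at hy
    exact (mul_eq_zero.1 hy).resolve_right (pow_ne_zero _ hZ)
  have hu0 : u ≠ 0 := hu.ne_zero
  obtain ⟨g, rfl⟩ : u ∣ w := by
    have : u ∣ derivative u * w := ⟨derivative w, by linear_combination -hV0 + hV⟩
    exact (IsCoprime.dvd_of_dvd_mul_left hu this)
  have hg : derivative g = 0 := by
    have : u ^ 2 * derivative g = 0 := by
      rw [hV, derivative_mul] at hV0
      linear_combination hV0
    exact (mul_eq_zero.1 this).resolve_left (pow_ne_zero _ hu0)
  obtain ⟨a, rfl⟩ := exists_eq_pow_of_derivative_eq_zero (q + 3) hg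
  exact ⟨a, mul_comm _ _⟩


end FuchsianPolynomials

/-! ### Construction of the Fuchsian equation. -/

section FuchsianEquation

open Polynomial

variable {k : Type*} [Field k]

theorem Polynomial.coeff_X_mul_derivative (f : k[X]) (n : ℕ) :
    (X * derivative f).coeff n = n * f.coeff n := by
  cases n with
  | zero => simp
  | succ n => rw [coeff_X_mul, coeff_derivative]; push_cast; ring

theorem Polynomial.coeff_X_sq_mul_derivative (f : k[X]) (n : ℕ) :
    (X ^ 2 * derivative (derivative f)).coeff n = n * (n - 1) * f.coeff n := by
  have : X ^ 2 * derivative (derivative f) =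
      X * derivative (X * derivative f) - X * derivative f := by
    rw [derivative_mul, derivative_X]; ring
  rw [this, coeff_sub, coeff_X_mul_derivative, coeff_X_mul_derivative]
  ring

/-- The numerator of the logarithmic derivative of `∏ b ∈ S, (X - C b) ^ z b`. -/
noncomputable def logDerivNumerator (S : Finset k) (z : k → k) : k[X] :=
  open Classical in ∑ b ∈ S, C (z b) * ∏ c ∈ S.erase b, (X - C c)

theorem logDerivNumerator_mul_prod (S : Finset k) (z : k → ℕ) :
    (∏ b ∈ S, (X - C b)) * derivative (∏ b ∈ S, (X - C b) ^ z b) =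
      logDerivNumerator S (fun b => (z b : k)) * ∏ b ∈ S, (X - C b) ^ z b := by
  classical
  rw [derivative_prod_finset, logDerivNumerator, Finset.mul_sum, Finset.sum_mul]
  refine Finset.sum_congr rfl fun b hb => ?_
  rw [← Finset.mul_prod_erase S (fun b => X - C b) hb,
    ← Finset.mul_prod_erase S (fun b => (X - C b) ^ z b) hb, derivative_X_sub_C_pow]
  rcases hz : z b with _ | m
  · simp
  · rw [Nat.add_sub_cancel, map_natCast]; ring

theorem natDegree_X_mul_logDerivNumerator_le (S : Finset k) (z : k → k) :
    (X * logDerivNumerator S z).natDegree ≤ S.card := by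
  classical
  rw [logDerivNumerator, Finset.mul_sum]
  refine natDegree_sum_le_of_forall_le _ _ fun b hb => ?_
  rw [mul_left_comm]
  refine (natDegree_C_mul_le _ _).trans (natDegree_mul_le.trans ?_)
  rw [natDegree_X, natDegree_finsetProd_X_sub_C_eq_card, Finset.card_erase_of_mem hb]
  have := Finset.card_pos.2 ⟨b, hb⟩
  omega

theorem coeff_X_mul_logDerivNumerator (S : Finset k) (z : k → k) :
    (X * logDerivNumerator S z).coeff S.card = ∑ b ∈ S, z b := by
  classical
  rw [logDerivNumerator, Finset.mul_sum, finsetSum_coeff]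
  refine Finset.sum_congr rfl fun b hb => ?_
  have hm : (∏ c ∈ S.erase b, (X - C c)).Monic := monic_prod_X_sub_C _ _
  have hd : (∏ c ∈ S.erase b, (X - C c)).natDegree = (S.erase b).card :=
    natDegree_finsetProd_X_sub_C_eq_card _ _
  rw [mul_left_comm, coeff_C_mul, ← Finset.card_erase_add_one hb, coeff_X_mul, ← hd, hm.coeff_natDegree, mul_one]

theorem eval_logDerivNumerator [DecidableEq k] (S : Finset k) (z : k → k) {b : k} (hb : b ∈ S) :
    (logDerivNumerator S z).eval b = z b * (∏ c ∈ S.erase b, (X - C c)).eval b := by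
  rw [logDerivNumerator, eval_finsetSum, Finset.sum_eq_single_of_mem b hb]
  · rw [eval_mul, eval_C]
    congr!
  · intro c _ hcb
    rw [eval_mul, eval_prod, Finset.prod_eq_zero (i := b), mul_zero]
    · simpa using ⟨hcb.symm, hb⟩
    · simp

/-- At a zero `b` of `u = (X - b) v` the hypothesis says that `v ^ (p - 2) Z` has zero derivative.
Since `p - 2 = -2` and `u' = v`, `u'' = 2 v'` at `b`, this is the vanishing of `N u'' - M u'` there.
As `u` has simple zeros, divisibility follows. -/
theorem exists_fuchsian_equation (p : ℕ) [CharP k p] [Fact p.Prime] (hp : 2 < p) (S T : Finset k)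
    (hST : Disjoint S T) (z : k → ℕ)
    (hF : ∀ b ∈ T, (derivative^[p - 1] ((∏ b ∈ T, (X - C b)) ^ (p - 2) *
      ∏ b ∈ S, (X - C b) ^ z b)).eval b = 0) :
    ∃ P : k[X], (∏ b ∈ S, (X - C b)) * derivative (derivative (∏ b ∈ T, (X - C b))) -
        logDerivNumerator S (fun b => (z b : k)) * derivative (∏ b ∈ T, (X - C b)) +
        P * ∏ b ∈ T, (X - C b) = 0 ∧
      (P ≠ 0 → P.natDegree + 2 ≤ S.card) ∧
      (X ^ 2 * P).coeff S.card =
        (T.card : k) * (∑ b ∈ S, (z b : k)) - (T.card : k) * (T.card - 1) := by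
  classical
  set u : k[X] := ∏ b ∈ T, (X - C b) with hu
  set N : k[X] := ∏ b ∈ S, (X - C b) with hN
  set Z : k[X] := ∏ b ∈ S, (X - C b) ^ z b with hZ
  set M : k[X] := logDerivNumerator S (fun b => (z b : k)) with hM
  have hNZ : N * derivative Z = M * Z := logDerivNumerator_mul_prod S z
  have hum : u.Monic := monic_prod_X_sub_C _ _
  have hNm : N.Monic := monic_prod_X_sub_C _ _
  have hud : u.natDegree = T.card := natDegree_finsetProd_X_sub_C_eq_card _ _
  have hNd : N.natDegree = S.card := natDegree_finsetProd_X_sub_C_eq_card _ _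
  have hdvd : u ∣ N * derivative (derivative u) - M * derivative u := by
    refine Finset.prod_dvd_of_coprime
      (fun a _ b _ hab => pairwise_coprime_X_sub_C Function.injective_id hab) fun b hb => ?_
    rw [dvd_iff_isRoot, IsRoot.def]
    set v : k[X] := ∏ c ∈ T.erase b, (X - C c) with hv
    have huv : u = (X - C b) * v := (Finset.mul_prod_erase T _ hb).symm
    have hvb : v.eval b ≠ 0 := by
      rw [hv, eval_prod, Finset.prod_ne_zero_iff]
      intro c hc
      simpa [sub_eq_zero] using (Finset.ne_of_mem_erase hc).symm
    have hZb : Z.eval b ≠ 0 := by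
      rw [hZ, eval_prod, Finset.prod_ne_zero_iff]
      intro c hc
      have : b ≠ c := fun h => Finset.disjoint_left.1 hST hc (h ▸ hb)
      simpa [sub_eq_zero] using fun h => absurd h this
    have h := hF b hb
    rw [huv, mul_pow, mul_assoc, eval_iterate_derivative_X_sub_C_pow_mul p hp, neg_eq_zero] at h
    have h' := congrArg (eval b) hNZ
    obtain ⟨q, rfl⟩ : ∃ q, p = q + 3 := ⟨p - 3, by omega⟩
    have hq : (q : k) + 3 = 0 := by
      have := CharP.cast_eq_zero k (q + 3)
      push_cast at this
      exact this
    simp only [show q + 3 - 2 = q + 1 by omega, derivative_mul, derivative_pow, eval_add, eval_mul,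
      eval_pow, Nat.add_sub_cancel, map_natCast, eval_natCast, Nat.cast_add, Nat.cast_one, eval_one,
      map_add, map_one] at h h'
    have h2 : eval b v ^ q * eval b Z * (2 * eval b (derivative v) * eval b N -
        eval b v * eval b M) = 0 := by
      linear_combination -eval b N * h + eval b v ^ (q + 1) * h' +
        eval b v ^ q * eval b Z * eval b (derivative v) * eval b N * hq
    have h3 := (mul_eq_zero.1 h2).resolve_left (mul_ne_zero (pow_ne_zero _ hvb) hZb)
    rw [huv]
    simp only [derivative_mul, derivative_sub, derivative_X, derivative_C, derivative_add, eval_sub,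
      eval_add, eval_mul, eval_X, eval_C, sub_zero, derivative_one, eval_one, eval_zero, sub_self]
    linear_combination h3
  obtain ⟨P, hP⟩ := hdvd
  have hA : (X ^ 2 * derivative (derivative u)).natDegree ≤ T.card :=
    natDegree_le_iff_coeff_eq_zero.2 fun n hn => by
      rw [coeff_X_sq_mul_derivative, coeff_eq_zero_of_natDegree_lt (hud ▸ hn), mul_zero]
  have hB : (X * derivative u).natDegree ≤ T.card :=
    natDegree_le_iff_coeff_eq_zero.2 fun n hn => by
      rw [coeff_X_mul_derivative, coeff_eq_zero_of_natDegree_lt (hud ▸ hn), mul_zero]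
  -- Multiplying by `X ^ 2` produces Euler operators, which do not raise degrees and act on
  -- coefficients by scalars. The coefficient in degree `S.card + T.card` then involves only top
  -- terms.
  have hR : X ^ 2 * P * u = N * (X ^ 2 * derivative (derivative u)) -
      X * M * (X * derivative u) := by
    linear_combination -X ^ 2 * hP
  have hMd := natDegree_X_mul_logDerivNumerator_le S (fun b => (z b : k))
  have hdeg : P ≠ 0 → P.natDegree + 2 ≤ S.card := by
    intro hP0
    have h1 : (X ^ 2 * P * u).natDegree ≤ S.card + T.card := by
      rw [hR]
      exact (natDegree_sub_le_of_le (natDegree_mul_le_of_le hNd.le hA)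
        (natDegree_mul_le_of_le hMd hB)).trans (max_self _).le
    rw [natDegree_mul (mul_ne_zero (pow_ne_zero _ X_ne_zero) hP0) hum.ne_zero, hud,
      natDegree_mul (pow_ne_zero _ X_ne_zero) hP0, natDegree_pow, natDegree_X] at h1
    omega
  refine ⟨-P, by linear_combination hP, by simpa using hdeg, ?_⟩
  have hPd : (X ^ 2 * P).natDegree ≤ S.card := by
    rcases eq_or_ne P 0 with h0 | h0
    · simp [h0]
    · rw [natDegree_mul (pow_ne_zero _ X_ne_zero) h0, natDegree_pow, natDegree_X]
      have := hdeg h0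
      omega
  have h1 := congrArg (fun f => coeff f (S.card + T.card)) hR
  have hu1 : u.coeff T.card = 1 := by rw [← hud]; exact hum.coeff_natDegree
  have hN1 : N.coeff S.card = 1 := by rw [← hNd]; exact hNm.coeff_natDegree
  simp only [coeff_sub] at h1
  rw [coeff_mul_add_eq_of_natDegree_le hPd hud.le, coeff_mul_add_eq_of_natDegree_le hNd.le hA,
    coeff_mul_add_eq_of_natDegree_le hMd hB, coeff_X_mul_logDerivNumerator, coeff_X_sq_mul_derivative,
    coeff_X_mul_derivative, hu1, hN1] at h1
  rw [mul_neg, coeff_neg]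
  linear_combination -h1

end FuchsianEquation


/-! ### Values of rational functions, and rational numbers modulo `p`. -/

section RationalFunctionValues

open Polynomial DefData

variable {k : Type*} [Field k]

theorem DefData.RegularAt.of_eq_div {f : RatFunc k} {A B : k[X]} {a : k} (hB : B.eval a ≠ 0)
    (h : f = algebraMap k[X] (RatFunc k) A / algebraMap k[X] (RatFunc k) B) : RegularAt a f := by
  subst h
  have hd := RatFunc.denom_div_dvd A B
  exact fun h0 => hB (eval_eq_zero_of_dvd_of_eval_eq_zero hd h0)

theorem DefData.valueAt_of_eq_div {f : RatFunc k} {A B : k[X]} {a : k} (hB : B.eval a ≠ 0)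
    (h : f = algebraMap k[X] (RatFunc k) A / algebraMap k[X] (RatFunc k) B) :
    valueAt a f = A.eval a / B.eval a := by
  have hd : f.denom.eval a ≠ 0 := RegularAt.of_eq_div hB h
  have h1 := congrArg (eval a) ((RatFunc.num_mul_eq_mul_denom_iff (fun h0 => hB (by simp [h0]))).2 h)
  rw [eval_mul, eval_mul] at h1
  rw [valueAt, RatFunc.eval, eval₂_id, eval₂_id, div_eq_div_iff hd hB, h1]

theorem DefData.RegularAtInfty.of_eq_div {f : RatFunc k} {A B : k[X]} (hB : B ≠ 0)
    (hAB : A.natDegree ≤ B.natDegree)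
    (h : f = algebraMap k[X] (RatFunc k) A / algebraMap k[X] (RatFunc k) B) :
    RegularAtInfty f := by
  have h1 := (RatFunc.num_mul_eq_mul_denom_iff hB).2 h
  rw [RegularAtInfty]
  rcases eq_or_ne A 0 with rfl | hA
  · have : f = 0 := by rw [h]; simp
    simp [this]
  · have hn : f.num ≠ 0 := by
      intro h0
      rw [h0, zero_mul] at h1
      exact mul_ne_zero hA f.denom_ne_zero h1.symm
    have h2 := congrArg natDegree h1
    rw [natDegree_mul hn hB, natDegree_mul hA f.denom_ne_zero] at h2
    omega

theorem DefData.valueAtInfty_of_eq_div {f : RatFunc k} {A B : k[X]} (hB : B ≠ 0)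
    (hAB : A.natDegree ≤ B.natDegree)
    (h : f = algebraMap k[X] (RatFunc k) A / algebraMap k[X] (RatFunc k) B) :
    valueAtInfty f = A.coeff B.natDegree / B.leadingCoeff := by
  have h1 := congrArg (fun g => coeff g (f.denom.natDegree + B.natDegree))
    ((RatFunc.num_mul_eq_mul_denom_iff hB).2 h)
  have hf : f.num.natDegree ≤ f.denom.natDegree := RegularAtInfty.of_eq_div hB hAB h
  rw [coeff_mul_add_eq_of_natDegree_le hf le_rfl, add_comm,
    coeff_mul_add_eq_of_natDegree_le hAB le_rfl] at h1
  rw [valueAtInfty, div_eq_div_iff (leadingCoeff_ne_zero.2 f.denom_ne_zero)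
    (leadingCoeff_ne_zero.2 hB)]
  exact h1

/-- The denominator of `q` divides `p - 1`, so it is invertible in `F`, where `p - 1 = -1`. -/
theorem Rat.cast_eq_neg_intCast {F : Type*} [Field F] {p : ℕ} [Fact p.Prime] [CharP F p] {q : ℚ}
    {z : ℤ} (h : ((p : ℚ) - 1) * q = z) : (q : F) = -(z : F) := by
  have hz : ((p : ℤ) - 1) * q.num = z * q.den := by
    have : ((p : ℚ) - 1) * q.num = z * q.den := by
      rw [← h, mul_assoc, Rat.mul_den_eq_num]
    exact_mod_cast this
  have hdvd : (q.den : ℤ) ∣ (p : ℤ) - 1 := by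
    have hc : IsCoprime (q.den : ℤ) q.num := (Int.isCoprime_iff_gcd_eq_one.2 q.reduced.symm)
    exact hc.dvd_of_dvd_mul_right ⟨z, by rw [hz]; ring⟩
  have hp := (Fact.out : p.Prime).two_le
  have hden : (q.den : F) ≠ 0 := by
    intro h0
    have h1 : p ∣ q.den := (CharP.cast_eq_zero_iff F p _).1 h0
    have h2 := (Int.natCast_dvd_natCast.2 h1).trans hdvd
    have h3 := Int.le_of_dvd (by omega) h2
    omega
  rw [Rat.cast_def, div_eq_iff hden]
  have := congrArg (Int.cast : ℤ → F) hz
  push_cast at this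
  rw [CharP.cast_eq_zero F p] at this
  linear_combination -this

end RationalFunctionValues


/-! ### Operators with coefficients over the common denominator `N`. -/

namespace DefData.DiffOp

open Polynomial

variable {k : Type*} [Field k] {L : DiffOp k} {N M P : k[X]}

theorem app_eq_zero_iff (hN : N ≠ 0)
    (h₁ : L.p₁ = algebraMap k[X] (RatFunc k) (-M) / algebraMap k[X] (RatFunc k) N)
    (h₂ : L.p₂ = algebraMap k[X] (RatFunc k) P / algebraMap k[X] (RatFunc k) N) (w : k[X]) :
    L.app w = 0 ↔ N * derivative (derivative w) - M * derivative w + P * w = 0 := by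
  have hN' : algebraMap k[X] (RatFunc k) N ≠ 0 := RatFunc.algebraMap_ne_zero hN
  have h : L.app w * algebraMap k[X] (RatFunc k) N =
      algebraMap k[X] (RatFunc k) (N * derivative (derivative w) - M * derivative w + P * w) := by
    rw [app, h₁, h₂]
    simp only [map_add, map_sub, map_mul, map_neg]
    field_simp
    ring
  rw [← mul_eq_zero_iff_right hN', h, FaithfulSMul.algebraMap_eq_zero_iff]

theorem wronskianApp_eq_zero (hN : N ≠ 0) {Z : k[X]} (hZ : N * derivative Z = M * Z)
    (h₁ : L.p₁ = algebraMap k[X] (RatFunc k) (-M) / algebraMap k[X] (RatFunc k) N) :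
    L.wronskianApp Z = 0 := by
  have hN' : algebraMap k[X] (RatFunc k) N ≠ 0 := RatFunc.algebraMap_ne_zero hN
  have hZ' := congrArg (algebraMap k[X] (RatFunc k)) hZ
  rw [map_mul, map_mul] at hZ'
  rw [wronskianApp, h₁, map_neg]
  field_simp
  linear_combination hZ'

theorem _root_.DefData.localParam_coe (b : k) :
    localParam (b : OnePoint k) = algebraMap k[X] (RatFunc k) (X - C b) := by
  rw [map_sub, RatFunc.algebraMap_X, RatFunc.algebraMap_C]
  rfl

section Fuchsian

variable {S : Finset k} {z : k → k}

theorem localParam_pow_mul_div [DecidableEq k] {b : k} (hb : b ∈ S) (n : ℕ) {f : RatFunc k}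
    (h : f = algebraMap k[X] (RatFunc k) P / algebraMap k[X] (RatFunc k) (∏ b ∈ S, (X - C b))) :
    localParam (b : OnePoint k) ^ (n + 1) * f = algebraMap k[X] (RatFunc k) ((X - C b) ^ n * P) /
      algebraMap k[X] (RatFunc k) (∏ c ∈ S.erase b, (X - C c)) := by
  have hX : algebraMap k[X] (RatFunc k) (X - C b) ≠ 0 :=
    RatFunc.algebraMap_ne_zero (X_sub_C_ne_zero b)
  have hP : algebraMap k[X] (RatFunc k) (∏ c ∈ S.erase b, (X - C c)) ≠ 0 :=
    RatFunc.algebraMap_ne_zero (monic_prod_X_sub_C _ _).ne_zero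
  rw [h, ← Finset.mul_prod_erase S (fun b => X - C b) hb, localParam_coe, map_mul, map_mul, map_pow]
  field_simp
  ring

theorem eval_prod_erase_ne_zero [DecidableEq k] (S : Finset k) (b : k) :
    (∏ c ∈ S.erase b, (X - C c)).eval b ≠ 0 := by
  rw [eval_prod, Finset.prod_ne_zero_iff]
  intro c hc
  simpa [sub_eq_zero] using (Finset.ne_of_mem_erase hc).symm

theorem isFuchsian_of_eq_div
    (h₁ : L.p₁ = algebraMap k[X] (RatFunc k) (-logDerivNumerator S z) /
      algebraMap k[X] (RatFunc k) (∏ b ∈ S, (X - C b)))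
    (h₂ : L.p₂ = algebraMap k[X] (RatFunc k) P /
      algebraMap k[X] (RatFunc k) (∏ b ∈ S, (X - C b)))
    (hP : (X ^ 2 * P).natDegree ≤ S.card) : L.IsFuchsian (S : Set k) := by
  classical
  have hNd : (∏ b ∈ S, (X - C b)).natDegree = S.card := natDegree_finsetProd_X_sub_C_eq_card _ _
  have hN : (∏ b ∈ S, (X - C b)) ≠ 0 := (monic_prod_X_sub_C _ _).ne_zero
  refine ⟨fun a ha => ?_, fun a ha => ?_, ?_⟩
  · have h : (∏ b ∈ S, (X - C b)).eval a ≠ 0 := by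
      rw [eval_prod, Finset.prod_ne_zero_iff]
      intro c hc
      have : a ≠ c := fun h => ha (h ▸ hc)
      simpa [sub_eq_zero] using this
    exact ⟨.of_eq_div h h₁, .of_eq_div h h₂⟩
  · have h := localParam_pow_mul_div ha 0 h₁
    rw [zero_add, pow_one] at h
    exact ⟨.of_eq_div (eval_prod_erase_ne_zero S a) h,
      .of_eq_div (eval_prod_erase_ne_zero S a) (localParam_pow_mul_div ha 1 h₂)⟩
  · refine ⟨.of_eq_div (A := -(X * logDerivNumerator S z)) hN ?_ ?_,
      .of_eq_div (A := X ^ 2 * P) hN (hP.trans hNd.ge) ?_⟩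
    · rw [natDegree_neg, hNd]; exact natDegree_X_mul_logDerivNumerator_le S z
    · rw [h₁, map_neg, map_neg, map_mul, RatFunc.algebraMap_X]; ring
    · rw [h₂, map_mul, map_pow, RatFunc.algebraMap_X]; ring

theorem hasExponentsAt_of_eq_div
    (h₁ : L.p₁ = algebraMap k[X] (RatFunc k) (-logDerivNumerator S z) /
      algebraMap k[X] (RatFunc k) (∏ b ∈ S, (X - C b)))
    (h₂ : L.p₂ = algebraMap k[X] (RatFunc k) P /
      algebraMap k[X] (RatFunc k) (∏ b ∈ S, (X - C b))) {b : k} (hb : b ∈ S) :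
    L.HasExponentsAt b (1 + z b) 0 := by
  classical
  have h := localParam_pow_mul_div hb 0 h₁
  rw [zero_add, pow_one] at h
  have he := eval_prod_erase_ne_zero S b
  constructor
  · rw [valueAt_of_eq_div he h, pow_zero, one_mul, eval_neg, eval_logDerivNumerator S z hb]
    field_simp
    ring
  · rw [valueAt_of_eq_div he (localParam_pow_mul_div hb 1 h₂)]
    simp

theorem hasExponentsAtInfty_of_eq_div
    (h₁ : L.p₁ = algebraMap k[X] (RatFunc k) (-logDerivNumerator S z) /
      algebraMap k[X] (RatFunc k) (∏ b ∈ S, (X - C b)))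
    (h₂ : L.p₂ = algebraMap k[X] (RatFunc k) P /
      algebraMap k[X] (RatFunc k) (∏ b ∈ S, (X - C b)))
    (hP : (X ^ 2 * P).natDegree ≤ S.card) {α β : k} (hadd : α + β = -1 - ∑ b ∈ S, z b)
    (hmul : α * β = (X ^ 2 * P).coeff S.card) : L.HasExponentsAtInfty α β := by
  have hNd : (∏ b ∈ S, (X - C b)).natDegree = S.card := natDegree_finsetProd_X_sub_C_eq_card _ _
  have hNm : (∏ b ∈ S, (X - C b)).Monic := monic_prod_X_sub_C _ _
  constructor
  · rw [valueAtInfty_of_eq_div (A := -(X * logDerivNumerator S z)) hNm.ne_zero, hNm.leadingCoeff,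
      hNd, coeff_neg, coeff_X_mul_logDerivNumerator, hadd]
    · ring
    · rw [natDegree_neg, hNd]; exact natDegree_X_mul_logDerivNumerator_le S z
    · rw [h₁, map_neg, map_neg, map_mul, RatFunc.algebraMap_X]; ring
  · rw [valueAtInfty_of_eq_div (A := X ^ 2 * P) hNm.ne_zero (hP.trans hNd.ge), hNm.leadingCoeff,
      hNd, hmul, div_one]
    rw [h₂, map_mul, map_pow, RatFunc.algebraMap_X]; ring

end Fuchsian

theorem isMinimalSolution_iff_of_forall {p : ℕ} {u : k[X]} (hu : u.Monic) (hLu : L.app u = 0)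
    (h : ∀ w, L.app w = 0 → ∃ a, w = a ^ p * u) (v : k[X]) : L.IsMinimalSolution v ↔ v = u := by
  have hle : ∀ w, w ≠ 0 → L.app w = 0 → u.natDegree ≤ w.natDegree := fun w hw0 hw => by
    obtain ⟨a, rfl⟩ := h w hw
    exact natDegree_le_of_dvd (dvd_mul_left _ _) hw0
  refine ⟨fun ⟨hm, hv, hmin⟩ => ?_, ?_⟩
  · obtain ⟨a, ha⟩ := h v hv
    exact eq_of_monic_of_dvd_of_natDegree_le hu hm ⟨a ^ p, by rw [ha, mul_comm]⟩
      (hmin u hu.ne_zero hLu)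
  · rintro rfl
    exact ⟨hu, hLu, hle⟩

section Solutions

variable {p : ℕ} [Fact p.Prime] [CharP k p] {u : k[X]}

/-- Multiplication by `u` identifies `k[x]^p` with the solution module. -/
theorem nonzeroPCurvature_of_forall (hu : u ≠ 0) (hLu : L.app u = 0)
    (h : ∀ w, L.app w = 0 → ∃ a, w = a ^ p * u) : L.NonzeroPCurvature p := by
  let v : L.polySolutions p := ⟨u, hLu⟩
  have hv : Function.Bijective (LinearMap.toSpanSingleton (pPowers k p) (L.polySolutions p) v) := by
    constructor
    · rw [injective_iff_map_eq_zero]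
      intro c hc
      have h1 : (c : k[X]) * u = 0 := congrArg Subtype.val hc
      exact Subtype.ext ((mul_eq_zero.1 h1).resolve_right hu)
    · rintro ⟨w, hw⟩
      obtain ⟨a, rfl⟩ := h w hw
      exact ⟨⟨a ^ p, a, rfl⟩, rfl⟩
  rw [NonzeroPCurvature, ← (LinearEquiv.ofBijective _ hv).rank_eq, Module.rank_self]

end Solutions

end DefData.DiffOp


/-! ### The logarithmic condition as a statement on polynomials. -/

section LogarithmicDifferentials

open Polynomial DefData

theorem Int.exists_toNat_neg_emod_add_eq {p : ℕ} (hp : p ≠ 0) (n : ℤ) :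
    ∃ e : ℤ, (((-n) % p).toNat : ℤ) + n = p * e := by
  have hp' : (p : ℤ) ≠ 0 := by exact_mod_cast hp
  refine ⟨-((-n) / p), ?_⟩
  rw [Int.toNat_of_nonneg (Int.emod_nonneg _ hp')]
  linear_combination Int.emod_add_mul_ediv (-n) p

theorem Derivation.iterate_algebraMap_polynomial {k : Type*} [Field k]
    (δ : Derivation k (RatFunc k) (RatFunc k)) (hδ : δ RatFunc.X = 1) (n : ℕ) (f : k[X]) :
    δ^[n] (algebraMap k[X] (RatFunc k) f) = algebraMap k[X] (RatFunc k) (derivative^[n] f) := by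
  induction n with
  | zero => rfl
  | succ n ih => rw [Function.iterate_succ_apply', Function.iterate_succ_apply', ih]
                 exact δ.ratFunc_algebraMap hδ _

variable {k : Type*} [Field k] {p : ℕ} [CharP k p]

/-- The consequence for the polynomial `∏ (X - C b) ^ (p - n b)` of the equation that characterizes
logarithmic differentials. -/
theorem iterate_derivative_of_iterate_ratDeriv [IsAlgClosed k] (hp : 2 < p) {n : k →₀ ℤ} {c : k} (hc : c ≠ 0)
    (hn : ratDeriv^[p - 1] (RatFunc.C c * n.prod fun b e => (RatFunc.X - RatFunc.C b) ^ e)⁻¹ = -1)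
    {S T : Finset k} (hS : ∀ b, b ∈ S ↔ n b ≠ 2 ∧ ¬ (p : ℤ) ∣ n b) (hT : ∀ b, b ∈ T ↔ n b = 2)
    {F : k[X]} (hF : F = (∏ b ∈ T, (X - C b)) ^ (p - 2) *
      ∏ b ∈ S, (X - C b) ^ ((-n b) % (p : ℤ)).toNat) :
    derivative^[p - 1] F ≠ 0 ∧ ∀ b ∈ T, (derivative^[p - 1] F).eval b = 0 := by
  classical
  have hp0 : p ≠ 0 := by omega
  choose e₀ he₀ using fun b => Int.exists_toNat_neg_emod_add_eq hp0 (n b)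
  -- The order of `h` at `b`: at a supersingular point `(p - 2) + 2 = p` gives `1`. Points with `p ∣
  -- n b` are absorbed entirely by `h`.
  set e : k → ℤ := fun b => if n b = 2 then 1 else e₀ b with he
  set x : k → RatFunc k := fun b => RatFunc.X - RatFunc.C b with hx
  have hx0 : ∀ b, x b ≠ 0 := RatFunc.X_sub_C_ne_zero
  have hax : ∀ b, algebraMap k[X] (RatFunc k) (X - C b) = x b := fun b => by
    rw [map_sub, RatFunc.algebraMap_X, RatFunc.algebraMap_C]
  obtain ⟨c', hc'⟩ := IsAlgClosed.exists_pow_nat_eq c (Nat.pos_of_ne_zero hp0)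
  have hc0 : c' ≠ 0 := by rintro rfl; exact hc (by rw [← hc', zero_pow hp0])
  set h : RatFunc k := RatFunc.C c' * ∏ b ∈ n.support, x b ^ e b with hh
  have hh0 : h ≠ 0 := mul_ne_zero ((_root_.map_ne_zero _).2 hc0)
    (Finset.prod_ne_zero_iff.2 fun b _ => zpow_ne_zero _ (hx0 b))
  have hTs : T = n.support.filter fun b => n b = 2 := by
    ext b
    simp only [hT, Finset.mem_filter, Finsupp.mem_support_iff]
    omega
  have hSs : S = n.support.filter fun b => n b ≠ 2 ∧ ¬ (p : ℤ) ∣ n b := by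
    ext b
    simp only [hS, Finset.mem_filter, Finsupp.mem_support_iff]
    refine ⟨fun h => ⟨fun h0 => h.2 (h0 ▸ dvd_zero _), h⟩, fun h => h.2⟩
  have hG : algebraMap k[X] (RatFunc k) F * (RatFunc.C c * n.prod fun b e => x b ^ e) = h ^ p := by
    rw [hF, hTs, hSs, map_mul, map_pow, map_prod, map_prod, Finset.prod_filter, Finset.prod_filter,
      hh, mul_pow, ← map_pow, hc', ← Finset.prod_pow, ← Finset.prod_pow, Finsupp.prod,
      mul_left_comm, ← Finset.prod_mul_distrib, ← Finset.prod_mul_distrib]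
    congr 1
    refine Finset.prod_congr rfl fun b _ => ?_
    simp only [map_pow, hax]
    have h2 : ((p - 2 : ℕ) : ℤ) = p - 2 := by omega
    rw [← zpow_natCast (x b ^ e b) p, ← zpow_mul]
    by_cases hb : n b = 2
    · simp only [hb, he, if_true, ne_eq, not_true_eq_false, false_and, if_false, mul_one]
      rw [← zpow_natCast, ← zpow_add₀ (hx0 b), h2]
      congr 1
      ring
    · have hez : ((-n b % p).toNat : ℤ) + n b = e b * p := by
        simp only [he, if_neg hb]
        rw [he₀, mul_comm]
      rw [← hez, if_neg hb, one_pow, one_mul, zpow_add₀ (hx0 b), zpow_natCast]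
      split_ifs with hd
      · rfl
      · have : (p : ℤ) ∣ n b := by
          by_contra h'
          exact hd ⟨hb, h'⟩
        rw [Int.emod_eq_zero_of_dvd ((dvd_neg).2 this)]
        simp
  have hG0 : RatFunc.C c * (n.prod fun b e => x b ^ e) ≠ 0 := by
    intro h0
    rw [h0, mul_zero] at hG
    exact pow_ne_zero p hh0 hG.symm
  obtain ⟨δ, hδ, -⟩ := RatFunc.exists_derivation k (RatFunc k)
  have hδ1 : δ RatFunc.X = 1 := hδ
  have hδr : (ratDeriv : RatFunc k → RatFunc k) = δ := funext (δ.eq_ratDeriv hδ1)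
  have : CharP (RatFunc k) p := charP_of_injective_algebraMap (algebraMap k (RatFunc k)).injective p
  have key : algebraMap k[X] (RatFunc k) (derivative^[p - 1] F) = -h ^ p := by
    rw [hδr] at hn
    rw [← δ.iterate_algebraMap_polynomial hδ1, (eq_mul_inv_iff_mul_eq₀ hG0).2 hG,
      δ.iterate_pow_char_mul p, hn, mul_neg_one]
  refine ⟨fun h0 => ?_, fun b hb => ?_⟩
  · rw [h0, map_zero, eq_comm, neg_eq_zero] at key
    exact pow_ne_zero p hh0 key
  · have hbs : b ∈ n.support := by rw [hTs] at hb; exact (Finset.mem_filter.1 hb).1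
    -- `h` may have poles away from `b`, so `h / (X - b)` is written as `A / B` with `B` nonzero at
    -- `b` before evaluating.
    set A : k[X] := C c' * ∏ a ∈ n.support.erase b, (X - C a) ^ (e a).toNat with hA
    set B : k[X] := ∏ a ∈ n.support.erase b, (X - C a) ^ (-e a).toNat with hB
    have hAB : h * algebraMap k[X] (RatFunc k) B = algebraMap k[X] (RatFunc k) ((X - C b) * A) := by
      have heb : e b = 1 := by simp only [he, (hT b).1 hb, if_true]
      rw [hh, ← Finset.mul_prod_erase _ _ hbs, heb, zpow_one, hA, hB, map_mul, map_mul, map_prod,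
        map_prod, RatFunc.algebraMap_C, hax, mul_assoc, mul_assoc, ← Finset.prod_mul_distrib,
        mul_left_comm]
      congr 2
      refine Finset.prod_congr rfl fun a _ => ?_
      rw [map_pow, map_pow, hax, ← zpow_natCast, ← zpow_natCast, ← zpow_add₀ (hx0 a)]
      congr 1
      omega
    have h1 : derivative^[p - 1] F * B ^ p = -((X - C b) * A) ^ p := by
      apply RatFunc.algebraMap_injective k
      rw [map_mul, key, map_neg, map_pow, map_pow, ← hAB]
      ring
    have hBb : B.eval b ≠ 0 := by
      rw [hB, eval_prod, Finset.prod_ne_zero_iff]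
      intro a ha
      simpa [sub_eq_zero] using fun h => absurd h (Finset.ne_of_mem_erase ha).symm
    have h2 := congrArg (eval b) h1
    simp only [eval_mul, eval_pow, eval_neg, eval_sub, eval_X, eval_C, sub_self, zero_mul,
      zero_pow hp0, neg_zero] at h2
    exact (mul_eq_zero.1 h2).resolve_right (pow_ne_zero _ hBb)

/-- The logarithmic derivative only depends on the exponents modulo `p`. -/
theorem ratDeriv_div_self_eq {Q g : RatFunc k} (hQ : Q ≠ 0) {N M Z : k[X]} (hN : N ≠ 0) (hZ : Z ≠ 0)
    (hNZ : N * derivative Z = M * Z) (h : Q * algebraMap k[X] (RatFunc k) Z = g ^ p) :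
    ratDeriv Q / Q = algebraMap k[X] (RatFunc k) (-M) / algebraMap k[X] (RatFunc k) N := by
  obtain ⟨δ, hδ, -⟩ := RatFunc.exists_derivation k (RatFunc k)
  have hδ1 : δ RatFunc.X = 1 := hδ
  have : CharP (RatFunc k) p := charP_of_injective_algebraMap (algebraMap k (RatFunc k)).injective p
  have h1 := congrArg δ h
  have h2 := δ.map_pow_char_mul p g 1
  rw [mul_one, Derivation.map_one_eq_zero, mul_zero] at h2
  have h3 : δ (algebraMap k[X] (RatFunc k) Z) = algebraMap k[X] (RatFunc k) (derivative Z) :=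
    δ.iterate_algebraMap_polynomial hδ1 1 Z
  rw [h2, Derivation.leibniz, smul_eq_mul, smul_eq_mul, h3] at h1
  have hNZ' := congrArg (algebraMap k[X] (RatFunc k)) hNZ
  rw [map_mul, map_mul] at hNZ'
  have hZ' : algebraMap k[X] (RatFunc k) Z ≠ 0 := RatFunc.algebraMap_ne_zero hZ
  rw [δ.eq_ratDeriv hδ1, div_eq_div_iff hQ (RatFunc.algebraMap_ne_zero hN), map_neg]
  apply mul_left_cancel₀ hZ'
  linear_combination algebraMap k[X] (RatFunc k) N * h1 - Q * hNZ'

end LogarithmicDifferentials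


/-! ### Types of points in terms of the divisor. -/

section Singularities

open Polynomial

namespace DefData.DeformationDatum

variable {p : ℕ} {k K : Type*} [Fact p.Prime] [Field k] [CharP k p] [Field K]
  [Algebra k K] [Algebra (RatFunc k) K] [IsScalarTower k (RatFunc k) K]
  (Δ : DeformationDatum p k K) {n : k →₀ ℤ}

theorem isCritical_iff (hn : ∀ b : k, ((p : ℚ) - 1) * (Δ.σ (b : OnePoint k) - 1) = n b) (b : k) :
    Δ.IsCritical (b : OnePoint k) ↔ n b ≠ 0 := by
  have hp : (2 : ℚ) ≤ p := by exact_mod_cast (Fact.out : p.Prime).two_le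
  rw [IsCritical, not_iff_not, ← Int.cast_eq_zero (α := ℚ), ← hn, mul_eq_zero, sub_eq_zero,
    sub_eq_zero, or_iff_right (by linarith)]

theorem isSupersingular_iff (hn : ∀ b : k, ((p : ℚ) - 1) * (Δ.σ (b : OnePoint k) - 1) = n b)
    (b : k) : Δ.IsSupersingular (b : OnePoint k) ↔ n b = 2 := by
  have hp : (2 : ℚ) ≤ p := by exact_mod_cast (Fact.out : p.Prime).two_le
  have hp1 : (p : ℚ) - 1 ≠ 0 := by linarith
  have h : Δ.σ (b : OnePoint k) = ((p : ℚ) + 1) / ((p : ℚ) - 1) ↔ n b = 2 := by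
    rw [eq_div_iff hp1, ← Int.cast_inj (α := ℚ), ← hn]
    constructor
    · intro h; push_cast; linear_combination h
    · intro h; push_cast at h; linear_combination h
  rw [IsSupersingular, isCritical_iff Δ hn, h]
  omega

theorem cast_σ (hn : ∀ b : k, ((p : ℚ) - 1) * (Δ.σ (b : OnePoint k) - 1) = n b) (F : Type*) [Field F]
    [CharP F p] (b : k) : ((Δ.σ (b : OnePoint k) : ℚ) : F) = 1 - n b := by
  rw [Rat.cast_eq_neg_intCast (p := p) (z := n b + p - 1)]
  · push_cast
    rw [CharP.cast_eq_zero F p]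
    ring
  · push_cast
    linear_combination hn b

theorem cast_σ_infty (hn : ((p : ℚ) - 1) * (Δ.σ OnePoint.infty + 1) = -(n.sum fun _ e => e : ℤ))
    (F : Type*) [Field F] [CharP F p] :
    ((Δ.σ OnePoint.infty : ℚ) : F) = (n.sum fun _ e => e : ℤ) - 1 := by
  rw [Rat.cast_eq_neg_intCast (p := p) (z := -(n.sum fun _ e => e : ℤ) - p + 1)]
  · push_cast
    rw [CharP.cast_eq_zero F p]
    ring
  · push_cast at hn ⊢
    linear_combination hn

theorem isSingular_iff (hn : ∀ b : k, ((p : ℚ) - 1) * (Δ.σ (b : OnePoint k) - 1) = n b) (b : k) :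
    Δ.IsSingular (b : OnePoint k) ↔ n b ≠ 2 ∧ ¬ (p : ℤ) ∣ n b := by
  rw [IsSingular, isCritical_iff Δ hn, isSupersingular_iff Δ hn, cast_σ Δ hn, ne_eq (1 - _ : ZMod p),
    sub_eq_self, ZMod.intCast_zmod_eq_zero_iff_dvd]
  refine ⟨fun h => h.2, fun h => ⟨fun h0 => h.2 (h0 ▸ dvd_zero _), h⟩⟩

/-- Follows from `n = a + (p - 1)(ν - 1)`. Modulo `p` the exponents of `Q` are thus those of `G`,
opposite to those of `Z`. -/
theorem exponent_eq (hn : ∀ b : k, ((p : ℚ) - 1) * (Δ.σ (b : OnePoint k) - 1) = n b) (b : k) :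
    1 + Δ.a (b : OnePoint k) - Δ.ν (b : OnePoint k) =
      n b + p * (1 - Δ.ν (b : OnePoint k)) := by
  have hp : (2 : ℚ) ≤ p := by exact_mod_cast (Fact.out : p.Prime).two_le
  have hp1 : (p : ℚ) - 1 ≠ 0 := by linarith
  have h := hn b
  rw [(Δ.σ_eq b).1] at h
  field_simp at h
  have : (1 + Δ.a (b : OnePoint k) - Δ.ν (b : OnePoint k) : ℚ) =
      n b + p * (1 - Δ.ν (b : OnePoint k)) := by
    linear_combination h
  exact_mod_cast this

end DefData.DeformationDatum

end Singularities

/-! ### The theorem. -/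

open DefData in
theorem proposition2p2 {p : ℕ} [Fact p.Prime] (hp : 2 < p) {k K : Type*} [Field k] [CharP k p]
    [IsAlgClosed k] [Field K] [Algebra k K] [Algebra (RatFunc k) K] [IsScalarTower k (RatFunc k) K]
    [FiniteDimensional (RatFunc k) K] [IsGalois (RatFunc k) K] (Δ : DeformationDatum p k K)
    (hnontrivial : ¬ Δ.IsTrivial) (hinfty : Δ.IsSingular OnePoint.infty) :
    {P | Δ.IsCritical P}.Finite ∧
    ∃ P₂ : Polynomial k,
      (P₂.natDegree + 3 ≤ Δ.r ∧
        P₂.coeff (Δ.r - 3) =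
          (Δ.u.natDegree : k) * ((Δ.u.natDegree : k) - ((Δ.σ OnePoint.infty : ℚ) : k)) ∧
        (Δ.operator P₂).app Δ.u = 0) ∧
      ((Δ.operator P₂).IsFuchsian Δ.finiteSingularities ∧
        (Δ.operator P₂).IsNormalized Δ.finiteSingularities ∧
        (∀ b ∈ Δ.finiteSingularities,
          (Δ.operator P₂).HasExponentsAt b ((Δ.σ (b : OnePoint k) : ℚ) : k) 0) ∧
        (Δ.operator P₂).HasExponentsAtInfty (-(Δ.u.natDegree : k))
          (-(Δ.u.natDegree : k) + ((Δ.σ OnePoint.infty : ℚ) : k))) ∧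
      ((Δ.operator P₂).NilpotentPCurvature ∧ (Δ.operator P₂).NonzeroPCurvature p) := by
  classical
  obtain ⟨c, n, hc, hnσ, hninf, hlog⟩ := Δ.exists_divisor
  have hp0 : p ≠ 0 := by omega
  set S : Finset k := n.support.filter fun b => n b ≠ 2 ∧ ¬ (p : ℤ) ∣ n b with hSdef
  set T : Finset k := n.support.filter fun b => n b = 2 with hTdef
  have hT : ∀ b, b ∈ T ↔ n b = 2 := fun b => by
    simp only [hTdef, Finset.mem_filter, Finsupp.mem_support_iff]
    omega
  have hS : ∀ b, b ∈ S ↔ n b ≠ 2 ∧ ¬ (p : ℤ) ∣ n b := fun b => by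
    simp only [hSdef, Finset.mem_filter, Finsupp.mem_support_iff]
    exact ⟨fun h => h.2, fun h => ⟨fun h0 => h.2 (h0 ▸ dvd_zero _), h⟩⟩
  have hST : Disjoint S T := Finset.disjoint_left.2 fun b hb hb' => ((hS b).1 hb).1 ((hT b).1 hb')
  have hSing : Δ.finiteSingularities = (S : Set k) := Set.ext fun b => by
    rw [Finset.mem_coe, hS, ← Δ.isSingular_iff hnσ]
    rfl
  have hu : Δ.u = ∏ b ∈ T, (Polynomial.X - Polynomial.C b) := by
    have : {b : k | Δ.IsSupersingular (b : OnePoint k)} = (T : Set k) := Set.ext fun b => by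
      rw [Finset.mem_coe, hT, ← Δ.isSupersingular_iff hnσ]
      rfl
    rw [DeformationDatum.u, this, finprod_mem_coe_finset]
  have hr : Δ.r = S.card + 1 := by
    have : {P | Δ.IsSingular P} = insert OnePoint.infty ((fun b : k => (b : OnePoint k)) '' S) := by
      ext P
      induction P using OnePoint.rec with
      | infty => simpa using hinfty
      | coe b => simp [hS, Δ.isSingular_iff hnσ]
    rw [DeformationDatum.r, this, Set.ncard_insert_of_notMem (by simp)
      ((S.finite_toSet).image _), Set.ncard_image_of_injective _ OnePoint.coe_injective,
      Set.ncard_coe_finset]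
  have hcrit : {P | Δ.IsCritical P}.Finite := by
    refine ((n.support.finite_toSet.image fun b : k => (b : OnePoint k)).insert
      OnePoint.infty).subset fun P hP => ?_
    induction P using OnePoint.rec with
    | infty => exact Set.mem_insert _ _
    | coe b => exact Set.mem_insert_of_mem _ ⟨b, by
        simpa using (Δ.isCritical_iff hnσ b).1 hP, rfl⟩
  set z : k → ℕ := fun b => (-n b % (p : ℤ)).toNat with hz
  have hzk : ∀ b, (z b : k) = -n b := fun b => by
    obtain ⟨e, he⟩ := Int.exists_toNat_neg_emod_add_eq hp0 (n b)
    have := congrArg (Int.cast : ℤ → k) he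
    push_cast at this
    rw [CharP.cast_eq_zero k p] at this
    linear_combination this
  obtain ⟨hF0, hFT⟩ := iterate_derivative_of_iterate_ratDeriv hp hc hlog hS hT rfl
  obtain ⟨P, hPu, hPdeg, hPcoeff⟩ := exists_fuchsian_equation p hp S T hST z hFT
  set u : Polynomial k := ∏ b ∈ T, (Polynomial.X - Polynomial.C b) with hudef
  set N : Polynomial k := ∏ b ∈ S, (Polynomial.X - Polynomial.C b) with hNdef
  set Z : Polynomial k := ∏ b ∈ S, (Polynomial.X - Polynomial.C b) ^ z b with hZdef
  set M : Polynomial k := logDerivNumerator S (fun b => (z b : k)) with hMdef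
  have hum : u.Monic := Polynomial.monic_prod_X_sub_C _ _
  have hud : u.natDegree = T.card := Polynomial.natDegree_finsetProd_X_sub_C_eq_card _ _
  have hN0 : N ≠ 0 := (Polynomial.monic_prod_X_sub_C _ _).ne_zero
  have hZ0 : Z ≠ 0 := Finset.prod_ne_zero_iff.2 fun b _ =>
    pow_ne_zero _ (Polynomial.X_sub_C_ne_zero b)
  have hNZ : N * Polynomial.derivative Z = M * Z := logDerivNumerator_mul_prod S z
  have husep : u.Separable :=
    Polynomial.separable_prod_X_sub_C_iff'.2 fun _ _ _ _ h => h
  have hsol : ∀ w, N * Polynomial.derivative (Polynomial.derivative w) -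
      M * Polynomial.derivative w + P * w = 0 → ∃ a, w = a ^ p * u := fun w hw =>
    Polynomial.exists_eq_pow_mul_of_wronskian p hp hN0 hZ0 hNZ husep hF0 hPu hw
  have h₁ : (Δ.operator P).p₁ = algebraMap _ (RatFunc k) (-M) / algebraMap _ (RatFunc k) N := by
    have hQ : Δ.Q = ∏ b ∈ S, localParam (b : OnePoint k) ^
        (1 + Δ.a (b : OnePoint k) - Δ.ν (b : OnePoint k)) := by
      rw [DeformationDatum.Q, hSing, finprod_mem_coe_finset]
    have hx : ∀ b : k, localParam (b : OnePoint k) ≠ 0 := RatFunc.X_sub_C_ne_zero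
    have hQ0 : Δ.Q ≠ 0 := by
      rw [hQ]
      exact Finset.prod_ne_zero_iff.2 fun b _ => zpow_ne_zero _ (hx b)
    choose e he using fun b => Int.exists_toNat_neg_emod_add_eq hp0 (n b)
    -- At `b` the product `Q Z` has exponent `n + p (1 - ν) + z`, and `z + n = p e`.
    refine ratDeriv_div_self_eq (p := p) (g := ∏ b ∈ S, localParam (b : OnePoint k) ^
      (e b + 1 - Δ.ν (b : OnePoint k))) hQ0 hN0 hZ0 hNZ ?_
    rw [hQ, hZdef, map_prod, ← Finset.prod_mul_distrib, ← Finset.prod_pow]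
    refine Finset.prod_congr rfl fun b _ => ?_
    rw [map_pow, ← localParam_coe, ← zpow_natCast, ← zpow_natCast, ← zpow_mul, ← zpow_add₀ (hx b),
      Δ.exponent_eq hnσ]
    congr 1
    linear_combination he b
  have h₂ : (Δ.operator P).p₂ = algebraMap _ (RatFunc k) P / algebraMap _ (RatFunc k) N := by
    change _ / (∏ᶠ b ∈ Δ.finiteSingularities, localParam (b : OnePoint k)) = _
    rw [hSing, finprod_mem_coe_finset, hNdef, map_prod]
    simp only [localParam_coe]
  have happ : ∀ w, (Δ.operator P).app w = 0 ↔ _ := DiffOp.app_eq_zero_iff hN0 h₁ h₂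
  have happu : (Δ.operator P).app u = 0 := (happ u).2 hPu
  have happsol : ∀ w, (Δ.operator P).app w = 0 → ∃ a, w = a ^ p * u := fun w hw =>
    hsol w ((happ w).1 hw)
  -- Modulo `p` the degree of `G` receives `-z b` from a finite singularity, `2` from a
  -- supersingular point and nothing from other points.
  have hsum : ((Δ.σ OnePoint.infty : ℚ) : k) = -1 - ∑ b ∈ S, (z b : k) + 2 * T.card := by
    have hterm : ∀ b ∈ n.support, ((n b : ℤ) : k) =
        (if n b ≠ 2 ∧ ¬ (p : ℤ) ∣ n b then -(z b : k) else 0) + (if n b = 2 then 2 else 0) := by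
      intro b _
      by_cases h2 : n b = 2
      · simp [h2]
      · by_cases hd : (p : ℤ) ∣ n b
        · simp [h2, hd, (CharP.intCast_eq_zero_iff k p _).2 hd]
        · simp [h2, hd, hzk]
    rw [Δ.cast_σ_infty hninf k, Finsupp.sum, Int.cast_sum, Finset.sum_congr rfl hterm,
      Finset.sum_add_distrib, ← Finset.sum_filter, ← Finset.sum_filter, Finset.sum_neg_distrib,
      Finset.sum_const, nsmul_eq_mul]
    ring
  have hScard : 2 ≤ S.card := by
    have h1 : S.card ≠ 1 := fun h => hnontrivial (by rw [DeformationDatum.IsTrivial, hr, h]; rfl)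
    -- Without finite singularities the equation is `w'' = 0`, solved by both `1` and `X`. The first
    -- forces `u = 1`, and then `X` would be a `p`-th power.
    have h0 : S.card ≠ 0 := by
      intro h
      have hP : P = 0 := by
        by_contra h0
        have := hPdeg h0
        omega
      have hM : M = 0 := by rw [hMdef, Finset.card_eq_zero.1 h, logDerivNumerator, Finset.sum_empty]
      obtain ⟨a, ha⟩ := hsol 1 (by simp [hP, hM])
      obtain ⟨b, hb⟩ := hsol Polynomial.X (by simp [hP, hM])
      have hu1 : u.natDegree = 0 := Polynomial.natDegree_eq_zero_of_isUnit
        (IsUnit.of_mul_eq_one (a ^ p) (by rw [mul_comm, ← ha]))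
      have hb0 : b ≠ 0 := by
        rintro rfl
        rw [zero_pow hp0, zero_mul] at hb
        exact Polynomial.X_ne_zero hb
      have h2 := congrArg Polynomial.natDegree hb
      rw [Polynomial.natDegree_mul (pow_ne_zero _ hb0) hum.ne_zero, hu1, add_zero,
        Polynomial.natDegree_pow, Polynomial.natDegree_X] at h2
      have := Nat.dvd_one.1 ⟨_, h2⟩
      omega
    omega
  have hPX : (Polynomial.X ^ 2 * P).natDegree ≤ S.card := by
    rcases eq_or_ne P 0 with h0 | h0
    · simp [h0]
    · rw [Polynomial.natDegree_mul (pow_ne_zero _ Polynomial.X_ne_zero) h0, Polynomial.natDegree_pow,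
        Polynomial.natDegree_X]
      have := hPdeg h0
      omega
  have hnil : (Δ.operator P).NilpotentPCurvature :=
    ⟨⟨u, hum.ne_zero, happu⟩, ⟨Z, hZ0, DiffOp.wronskianApp_eq_zero hN0 hNZ h₁⟩⟩
  have hmin := DiffOp.isMinimalSolution_iff_of_forall hum happu happsol
  rw [hSing, hu, hr, hud]
  refine ⟨hcrit, P, ⟨?_, ?_, happu⟩, ⟨DiffOp.isFuchsian_of_eq_div h₁ h₂ hPX,
    ⟨hnil, u, (hmin u).2 rfl, fun v => (hmin v).1, fun b hb => ?_⟩, fun b hb => ?_, ?_⟩, hnil,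
    DiffOp.nonzeroPCurvature_of_forall hum.ne_zero happu happsol⟩
  · rcases eq_or_ne P 0 with h0 | h0
    · simp [h0]; omega
    · have := hPdeg h0
      omega
  · obtain ⟨m, hm⟩ : ∃ m, S.card = m + 2 := ⟨S.card - 2, by omega⟩
    rw [hm, Polynomial.coeff_X_pow_mul] at hPcoeff
    rw [hm, show m + 2 + 1 - 3 = m by omega, hPcoeff, hsum]
    ring
  · rw [hudef, Polynomial.eval_prod, Finset.prod_ne_zero_iff]
    intro a ha
    have : b ≠ a := fun h => Finset.disjoint_left.1 hST hb (h ▸ ha)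
    simpa [sub_eq_zero] using this
  · have := DiffOp.hasExponentsAt_of_eq_div h₁ h₂ hb
    rwa [hzk, ← sub_eq_add_neg, ← Δ.cast_σ hnσ] at this
  · refine DiffOp.hasExponentsAtInfty_of_eq_div h₁ h₂ hPX ?_ ?_
    · rw [hsum]; ring
    · rw [hPcoeff, hsum]; ring
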